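/- **Model.** Let $G=(V,E)$ be a finite undirected graph, each node $u$ starting at time $0$ with a finite token set, and let $H$ be a hash function without collisions among the sets of tokens present in the network. $T_u$ denotes the current token set of $u$. Each node $u$ repeats forever the following loop of the asynchronous mobile telephone model: 1. it passes the advertisement $\langle H(T_u),|T_u|,u\rangle$ to `update`; 2. `receiveAds` returns the set $A$ of advertisements that $u$ received since its previous `receiveAds` returned; 3. `Select`: put $\hat s=\min\{s:\langle h,s,*\rangle\in A,\ h\ne H(T_u)\}$ and $\hat N=\{w:\langle h,\hat s,w\rangle\in A,\ h\neq H(T_u)\}$; if $\hat N=\emptyset$ go back to 1, otherwise choose $w\in\hat N$ uniformly at random; 4. `blockForConn`$(w)$: a connection proposal is delivered to $w$, which rejects it if a connection that it accepted earlier is still open, and accepts it otherwise; $u$ then learns the answer. If rejected, $u$ goes back to 1; 5. `Communicate`$(w)$: each of $u,w$ that lacks some token of the other receives one (arbitrary) such token; then the connection is closed and $u$ goes back to 1. Events are atomic and carry real time stamps; only finitely many happen in bounded time. Which event happens next, and when (and which token is transferred), is decided by an adversary that knows the entire history including all past random choices, subject, in every possible execution, to these guarantees for constants $\delta_{update},\delta_{conn},b_{max},R_b>0$: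 a node at the top of its loop calls `update` within time $\delta_{update}$; when a node calls `update` at time $t$, each of its neighbours receives an advertisement from it during $[t,t+\delta_{update}]$, and a received advertisement is always the one its sender most recently passed to `update`; `blockForConn` returns within $\delta_{conn}$; `Communicate`, which transmits at most two tokens, returns within $2b_{max}/R_b$; and `receiveAds` returns within $\delta_{max}$, where $\delta_{max}=\delta_{conn}+\delta_{update}+b_{max}/R_b$. **Minimum productive subgraph.** For a network state at time $t$ with token sets $T_u$, let $s_u=\min\{|T_w| : w\in N(u),\ H(T_w)\ne H(T_u)\}$ and $N_u=\{w\in N(u): H(T_w)\neq H(T_u),\ |T_w|=s_u\}$. The productive subgraph has the edges $\{u,w\}$ with $w\in N_u$ or $u\in N_w$. Let $S_{min}$ be the set of nodes whose token set has the minimum size in the network, $L_{min}$ the nodes outside $S_{min}$ with a neighbour in $S_{min}$, and $R_{min}$ the nodes in $S_{min}$ with a neighbour outside $S_{min}$. The minimum productive subgraph $G_{min}(t)$ consists of the edges of the productive subgraph between $L_{min}$ and $R_{min}$; $N_{min}$ and $deg_{min}$ are its neighbour sets and degrees. A node *connects productively* in a time interval if, in the interval, it takes part (on either side) in the token transfer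 of a connection and thereby receives a token that it did not have. **Lemma.** There is a universal constant $C>0$ such that for all networks, parameters and adversaries as above the following holds. Let $t_1\ge 0$, fix any possible history of the execution up to time $t_1$ (where, of the events that happen exactly at time $t_1$, any initial part may be counted as belonging to this history), and let $v\in R_{min}(t_1)$ in the state that it leads to. Then there is a time $t_2$ with $t_1\le t_2\le t_1+C\,\delta_{max}$ such that, conditionally on that history, with probability at least $$1-\prod_{u\in N_{min}(v)}\Bigl(1-\frac1{deg_{min}(u)}\Bigr)$$ the node $v$ connects productively during $[t_1,t_2]$, through an event after that history. Here $N_{min}$ and $deg_{min}$ are taken in $G_{min}(t_1)$. Moreover there is a number $N$ such that in every possible continuation the $N$-th event after that history is later than $t_2$. -/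

import Mathlib

/-!
The asynchronous mobile telephone model (aMTM), the asynchronous random diffusion gossip
algorithm run in it, and the (minimum) productive subgraph of a network state.

An execution is a sequence of instantaneous atomic events, each with a real time stamp.  An
adaptive adversary, which sees the whole history (including all past random choices), decides
which event happens next and when; the only randomness is the choice of a neighbour made in
`Select`.
-/

noncomputable section

namespace AMTM

/-- The timing parameters of an execution: `δUpdate`, `δConn`, the minimum bit rate `Rb` of a
connection, and the maximum size `bMax` (in bits) of a token. -/
structure Params where
  δUpdate : ℝ
  δConn : ℝ
  bMax : ℝ
  Rb : ℝ
  δUpdate_pos : 0 < δUpdate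
  δConn_pos : 0 < δConn
  bMax_pos : 0 < bMax
  Rb_pos : 0 < Rb

/-- `δ_max = δ_conn + δ_update + b_max / R_b`. -/
def Params.δMax (p : Params) : ℝ := p.δConn + p.δUpdate + p.bMax / p.Rb

/-- An advertisement `⟨H(T), |T|, u⟩`. -/
structure Ad (V β : Type*) where
  hash : β
  size : ℕ
  sender : V

/-- Where a node currently is in the loop
`update; receiveAds; Select; blockForConn; Communicate`. -/
inductive Phase (V : Type*) where
  /-- at the top of the loop, about to call `update` -/
  | ready
  /-- `update` has been called, the node is in `receiveAds` -/
  | listening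
  /-- in `blockForConn v`, the proposal has not reached `v` yet -/
  | proposing (v : V)
  /-- in `blockForConn`, the proposal was rejected, the answer is under way -/
  | rejected
  /-- in `blockForConn v`, the proposal was accepted by `v`, the answer is under way -/
  | accepted (v : V)
  /-- in `Communicate v`, before the transfer of tokens -/
  | connected (v : V)
  /-- in `Communicate v`, after the transfer of tokens -/
  | closing (v : V)

/-- A state of the whole network. -/
structure State (V τ β : Type*) where
  /-- the token set of each node -/
  tok : V → Finset τ
  /-- the advertisement most recently passed to `update` by each node, if any -/
  ad : V → Option (Ad V β)
  /-- the advertisements received by each node since its previous `receiveAds` returned -/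
  inbox : V → Set (Ad V β)
  /-- the position of each node in its loop -/
  phase : V → Phase V

/-- The atomic events. -/
inductive Action (V τ : Type*) where
  /-- `u` calls `GetTag` and passes the result to `update` -/
  | update (u : V)
  /-- `u` receives the current advertisement of `w` -/
  | receive (u w : V)
  /-- `receiveAds` returns at `u`, and `u` calls `Select` on the advertisements -/
  | select (u : V)
  /-- the proposal of `u` reaches `v`, which accepts or rejects it -/
  | propose (u v : V)
  /-- `blockForConn` returns at `u` -/
  | resolve (u : V)
  /-- in the connection opened by `u` to `v`, `x` (if any) is passed from `u` to `v`, and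
  `y` (if any) is passed from `v` to `u` -/
  | exchange (u v : V) (x y : Option τ)
  /-- `Communicate v` returns at `u`, which closes the connection -/
  | close (u v : V)

/-- The initial state: nobody has advertised anything, everybody is at the top of the loop. -/
def start {V τ : Type*} (β : Type*) (T₀ : V → Finset τ) : State V τ β where
  tok := T₀
  ad := fun _ => none
  inbox := fun _ => ∅
  phase := fun _ => Phase.ready

section Select

variable {V τ β : Type*} [Fintype V]

/-- `ŝ = min {s | ⟨h, s, *⟩ ∈ A, h ≠ H(T)}`. -/
def sHat (H : Finset τ → β) (T : Finset τ) (A : Set (Ad V β)) : ℕ :=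
  sInf {s | ∃ a ∈ A, a.hash ≠ H T ∧ a.size = s}

open scoped Classical in
/-- `N̂ = {v | ⟨h, ŝ, v⟩ ∈ A, h ≠ H(T)}`. -/
def NHat (H : Finset τ → β) (T : Finset τ) (A : Set (Ad V β)) : Finset V :=
  Finset.univ.filter fun v =>
    ∃ a ∈ A, a.hash ≠ H T ∧ a.size = sHat H T A ∧ a.sender = v

end Select

section Dynamics

variable {V τ β : Type*}

/-- `v` has accepted a proposal and the resulting connection is still open. -/
def State.Engaged (s : State V τ β) (v : V) : Prop :=
  ∃ u, s.phase u = Phase.accepted v ∨ s.phase u = Phase.connected v ∨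
    s.phase u = Phase.closing v

/-- `x` is a token of the set `D`, and is absent only if `D` is empty. -/
def Picks (D : Finset τ) : Option τ → Prop
  | none => D = ∅
  | some a => a ∈ D

/-- The events that are possible in a given state.  In `Communicate`, each endpoint that lacks a
token of the other one receives such a token (an arbitrary one). -/
def Enabled [DecidableEq τ] (G : SimpleGraph V) (s : State V τ β) : Action V τ → Prop
  | .update u => s.phase u = Phase.ready
  | .receive u w => G.Adj w u ∧ s.ad w ≠ none
  | .select u => s.phase u = Phase.listening
  | .propose u v => s.phase u = Phase.proposing v
  | .resolve u => s.phase u = Phase.rejected ∨ ∃ v, s.phase u = Phase.accepted v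
  | .exchange u v x y => s.phase u = Phase.connected v ∧
      Picks (s.tok u \ s.tok v) x ∧ Picks (s.tok v \ s.tok u) y
  | .close u v => s.phase u = Phase.closing v

/-- `s` with node `u` moved to phase `φ`. -/
def State.setPhase [DecidableEq V] (s : State V τ β) (u : V) (φ : Phase V) : State V τ β :=
  { s with phase := Function.update s.phase u φ }

open scoped Classical in
/-- The (random) effect of an event.  A call to `Select` returns a uniformly random element of
`N̂`, or null if there is none (in particular if no advertisement was received). -/
def effect [Fintype V] [DecidableEq V] [DecidableEq τ] (H : Finset τ → β) (s : State V τ β) :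
    Action V τ → PMF (State V τ β)
  | .update u => PMF.pure
      { s.setPhase u Phase.listening with
        ad := Function.update s.ad u (some ⟨H (s.tok u), (s.tok u).card, u⟩) }
  | .receive u w => PMF.pure
      { s with inbox := Function.update s.inbox u (s.inbox u ∪ {a | s.ad w = some a}) }
  | .select u =>
      let s' : State V τ β := { s with inbox := Function.update s.inbox u ∅ }
      if hN : (NHat H (s.tok u) (s.inbox u)).Nonempty then
        (PMF.uniformOfFinset (NHat H (s.tok u) (s.inbox u)) hN).map
          fun v => s'.setPhase u (Phase.proposing v)
      else PMF.pure (s'.setPhase u Phase.ready)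
  | .propose u v => PMF.pure
      (s.setPhase u (if s.Engaged v then Phase.rejected else Phase.accepted v))
  | .resolve u => PMF.pure
      (match s.phase u with
        | .accepted v => s.setPhase u (Phase.connected v)
        | _ => s.setPhase u Phase.ready)
  | .exchange u v x y => PMF.pure
      { s.setPhase u (Phase.closing v) with
        tok := Function.update (Function.update s.tok v (s.tok v ∪ x.toFinset)) u
          (s.tok u ∪ y.toFinset) }
  | .close u _ => PMF.pure (s.setPhase u Phase.ready)

end Dynamics

/-- One entry of a history: an event, its time, and the state right after it. -/
structure Record (V τ β : Type*) where
  time : ℝ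
  action : Action V τ
  state : State V τ β

/-- A finite history, most recent entry first. -/
abbrev History (V τ β : Type*) := List (Record V τ β)

/-- The adversary decides from the history when the next event happens and what it is. -/
abbrev Adversary (V τ β : Type*) := History V τ β → ℝ × Action V τ

section Executions

variable {V τ β : Type*}

/-- The state at the end of a history. -/
def History.state (T₀ : V → Finset τ) : History V τ β → State V τ β
  | [] => start β T₀
  | r :: _ => r.state

/-- The time of the last event of a history (executions start at time `0`). -/
def History.clock : History V τ β → ℝ
  | [] => 0
  | r :: _ => r.time

/-- The first `n` entries of an infinite sequence of records, as a history. -/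
def prefixHistory (ρ : ℕ → Record V τ β) : ℕ → History V τ β
  | 0 => []
  | n + 1 => ρ n :: prefixHistory ρ n

variable [Fintype V] [DecidableEq V] [DecidableEq τ]

/-- The law of the next record after the history `h`. -/
def nextRecord (H : Finset τ → β) (T₀ : V → Finset τ) (σ : Adversary V τ β)
    (h : History V τ β) : PMF (Record V τ β) :=
  (effect H (History.state T₀ h) (σ h).2).map fun s => ⟨(σ h).1, (σ h).2, s⟩

/-- The law of the history after `n` further events, starting from the history `h`. -/
def run (H : Finset τ → β) (T₀ : V → Finset τ) (σ : Adversary V τ β) :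
    ℕ → History V τ β → PMF (History V τ β)
  | 0, h => PMF.pure h
  | n + 1, h => (nextRecord H T₀ σ h).bind fun r => run H T₀ σ n (r :: h)

/-- `ρ` is a possible infinite execution against the adversary `σ`. -/
def IsExecution (H : Finset τ → β) (T₀ : V → Finset τ) (σ : Adversary V τ β)
    (ρ : ℕ → Record V τ β) : Prop :=
  ∀ n, ρ n ∈ (nextRecord H T₀ σ (prefixHistory ρ n)).support

/-- The guarantees of the model for one infinite execution. -/
structure Guarantees (p : Params) (G : SimpleGraph V) (T₀ : V → Finset τ)
    (ρ : ℕ → Record V τ β) : Prop where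
  /-- only possible events happen -/
  enabled : ∀ n, Enabled G (History.state T₀ (prefixHistory ρ n)) (ρ n).action
  /-- time does not run backwards -/
  mono : ∀ n, History.clock (prefixHistory ρ n) ≤ (ρ n).time
  /-- only finitely many events happen in bounded time -/
  unbounded : ∀ B : ℝ, ∃ n, B < (ρ n).time
  /-- a node at the top of its loop calls `update` within `δ_update` -/
  update_bound : ∀ n u, (History.state T₀ (prefixHistory ρ n)).phase u = Phase.ready →
    ∃ m, n ≤ m ∧ (ρ m).action = Action.update u ∧
      (ρ m).time ≤ History.clock (prefixHistory ρ n) + p.δUpdate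
  /-- after a call to `update`, every neighbour receives an advertisement of the caller within
  `δ_update` -/
  ad_bound : ∀ n w u, (ρ n).action = Action.update w → G.Adj w u →
    ∃ m, n < m ∧ (ρ m).action = Action.receive u w ∧ (ρ m).time ≤ (ρ n).time + p.δUpdate
  /-- `receiveAds` returns within `δ_max` -/
  receive_bound : ∀ n u, (History.state T₀ (prefixHistory ρ n)).phase u = Phase.listening →
    ∃ m, n ≤ m ∧ (ρ m).action = Action.select u ∧
      (ρ m).time ≤ History.clock (prefixHistory ρ n) + p.δMax
  /-- `blockForConn` returns within `δ_conn` -/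
  conn_bound : ∀ n u v, (History.state T₀ (prefixHistory ρ n)).phase u = Phase.proposing v →
    ∃ m, n ≤ m ∧ (ρ m).action = Action.resolve u ∧
      (ρ m).time ≤ History.clock (prefixHistory ρ n) + p.δConn
  /-- `Communicate`, which transmits at most two tokens, returns within `2 b_max / R_b` -/
  comm_bound : ∀ n u v, (History.state T₀ (prefixHistory ρ n)).phase u = Phase.connected v →
    ∃ m, n ≤ m ∧ (ρ m).action = Action.close u v ∧
      (ρ m).time ≤ History.clock (prefixHistory ρ n) + 2 * p.bMax / p.Rb

/-- The adversary respects the guarantees of the model, whatever the random choices are. -/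
def Adversary.Admissible (p : Params) (G : SimpleGraph V) (H : Finset τ → β)
    (T₀ : V → Finset τ) (σ : Adversary V τ β) : Prop :=
  ∀ ρ : ℕ → Record V τ β, IsExecution H T₀ σ ρ → Guarantees p G T₀ ρ

end Executions

/-- The event is the transfer of tokens in a connection that `v` takes part in (on either side),
and `v` receives a token it did not have. -/
def Action.ProductiveFor {V τ : Type*} (v : V) : Action V τ → Prop
  | .exchange u w x y => (v = w ∧ x ≠ none) ∨ (v = u ∧ y ≠ none)
  | _ => False

/-- In the history `h'`, which continues `h`, the node `v` connects productively during `[a, b]`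
after `h`. -/
def ConnectsProductively {V τ β : Type*} (h h' : History V τ β) (v : V) (a b : ℝ) : Prop :=
  ∃ new : History V τ β, h' = new ++ h ∧
    ∃ r ∈ new, a ≤ r.time ∧ r.time ≤ b ∧ r.action.ProductiveFor v

section ProductiveSubgraph

variable {V τ β : Type*}

/-- `s_u`, the smallest token set size among the neighbours of `u` whose hash differs from that
of `u`. -/
def sVal (G : SimpleGraph V) (H : Finset τ → β) (T : V → Finset τ) (u : V) : ℕ :=
  sInf {s | ∃ v, G.Adj u v ∧ H (T v) ≠ H (T u) ∧ (T v).card = s}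

/-- `N_u`, the neighbours of `u` whose hash differs from that of `u` and whose token set size
is `s_u`. -/
def NVal (G : SimpleGraph V) (H : Finset τ → β) (T : V → Finset τ) (u : V) : Set V :=
  {v | G.Adj u v ∧ H (T v) ≠ H (T u) ∧ (T v).card = sVal G H T u}

/-- The productive subgraph: `{u, v}` is an edge if `v ∈ N_u` or `u ∈ N_v`. -/
def productiveSubgraph (G : SimpleGraph V) (H : Finset τ → β) (T : V → Finset τ) :
    SimpleGraph V where
  Adj u v := v ∈ NVal G H T u ∨ u ∈ NVal G H T v
  symm := ⟨fun _ _ h => h.symm⟩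
  loopless := ⟨fun u h => h.elim (fun h => G.loopless.irrefl u h.1) fun h => G.loopless.irrefl u h.1⟩

/-- The nodes with the smallest token set size in the network. -/
def Smin (T : V → Finset τ) : Set V := {u | ∀ w, (T u).card ≤ (T w).card}

/-- The nodes outside `S_min` with a neighbour in `S_min`. -/
def Lmin (G : SimpleGraph V) (T : V → Finset τ) : Set V :=
  {u | u ∉ Smin T ∧ ∃ v ∈ Smin T, G.Adj u v}

/-- The nodes in `S_min` with a neighbour outside `S_min`. -/
def Rmin (G : SimpleGraph V) (T : V → Finset τ) : Set V :=
  {v | v ∈ Smin T ∧ ∃ u, u ∉ Smin T ∧ G.Adj v u}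

/-- The minimum productive subgraph: the edges of the productive subgraph between `L_min` and
`R_min`. -/
def minProductiveSubgraph (G : SimpleGraph V) (H : Finset τ → β) (T : V → Finset τ) :
    SimpleGraph V where
  Adj u v := (productiveSubgraph G H T).Adj u v ∧
    ((u ∈ Lmin G T ∧ v ∈ Rmin G T) ∨ (v ∈ Lmin G T ∧ u ∈ Rmin G T))
  symm := ⟨fun _ _ h => ⟨h.1.symm, h.2.symm⟩⟩
  loopless := ⟨fun u h => (productiveSubgraph G H T).loopless.irrefl u h.1⟩

open scoped Classical in
/-- `N_min(v)`. -/
def Nmin [Fintype V] (G : SimpleGraph V) (H : Finset τ → β) (T : V → Finset τ) (v : V) :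
    Finset V :=
  (minProductiveSubgraph G H T).neighborFinset v

open scoped Classical in
/-- `deg_min(u)`. -/
def degMin [Fintype V] (G : SimpleGraph V) (H : Finset τ → β) (T : V → Finset τ) (u : V) : ℕ :=
  (minProductiveSubgraph G H T).degree u

end ProductiveSubgraph

end AMTM

end

/-!
The argument follows a node `v ∈ R_min` from the history `h` on, writing `D` for `δ_max`, and has a
deterministic and a probabilistic half.

*Deterministic half.* Token sets only grow and `v` has the smallest one, so as long as `v` has not
connected productively, every connection between `v` and a node whose set is not contained in that
of `v` is productive for `v`. A node goes through its loop in `O(D)`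
(`Trajectory.exists_ready`, `Trajectory.exists_update`, `Trajectory.exists_select`). Hence by time
`t₁ + 5D` all advertisements in force, and by `t₁ + 11D` all inboxes, describe token sets held since
`h`; from then on whoever selects `v` knows a token that `v` lacks, and by `t₁ + 15D` every older
proposal or connection to `v` is over (`Trajectory.safeFor`). If after that time a node selects
`v`, then its proposal is either accepted, or rejected because of another open connection to `v`;
both connections are productive for `v` and transfer their tokens by `t₁ + 31D`
(`Trajectory.exists_productive_of_proposing`). Moreover each `u ∈ N_min(v)` makes, by `t₁ + 27D`, a
selection with a fresh advertisement of `v` in its inbox; then the candidates are nodes of minimum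
size at `h`, so there are at most `deg_min(u)` of them and `v` is one
(`Trajectory.exists_qualified_select`, `card_le_degMin`).

*Probabilistic half.* The adversary interleaves these selections adaptively. Induction on the number
of events still to come bounds the failure probability by the product over the nodes of `N_min(v)`
whose selection is still to come (`toOuterMeasure_run_compl_le`): such a selection of `u` leaves
failure possible only with probability `1 - 1 / deg_min(u)`, and no other event changes the bound.
The guarantees speak of infinite executions, the probability of finite runs; every possible history
extends to an execution (`Possible.exists_extends`), and since every event has finitely many
outcomes, König's lemma gives a number of events after which the time is past `t₁ + 31D` in all
continuations (`exists_forall_lt_clock`).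
-/

namespace AMTM

variable {V τ β : Type*}

/-! ### One step of the dynamics -/

/-- The node whose position in its loop is affected by the event, if any. -/
def Action.mover : Action V τ → Option V
  | .update u => some u
  | .receive _ _ => none
  | .select u => some u
  | .propose u _ => some u
  | .resolve u => some u
  | .exchange u _ _ _ => some u
  | .close u _ => some u

/-- A node receives a token in a connection opened by a node that knows a token it lacks. -/
lemma productiveFor_of_enabled_exchange [DecidableEq τ] {G : SimpleGraph V} {s : State V τ β}
    {u v : V} {x y : Option τ}
    (he : Enabled G s (.exchange u v x y)) (h : ¬ s.tok u ⊆ s.tok v) :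
    (Action.exchange u v x y).ProductiveFor v := by
  refine Or.inl ⟨rfl, ?_⟩
  rintro rfl
  exact h (Finset.sdiff_eq_empty_iff_subset.1 he.2.1)

section Step

variable [Fintype V] [DecidableEq V] [DecidableEq τ] {G : SimpleGraph V} {H : Finset τ → β}
  {s s' : State V τ β} {a : Action V τ}

lemma mem_support_effect_select {u : V} (h : s' ∈ (effect H s (.select u)).support) :
    s'.tok = s.tok ∧ s'.ad = s.ad ∧ s'.inbox = Function.update s.inbox u ∅ ∧
      ∃ φ, s'.phase = Function.update s.phase u φ ∧
        (φ = .ready ∨ ∃ w ∈ NHat H (s.tok u) (s.inbox u), φ = .proposing w) := by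
  simp only [effect] at h
  split_ifs at h with hN
  · simp only [PMF.support_map, PMF.support_uniformOfFinset, Set.mem_image] at h
    obtain ⟨w, hw, rfl⟩ := h
    exact ⟨rfl, rfl, rfl, _, rfl, Or.inr ⟨w, hw, rfl⟩⟩
  · simp only [PMF.support_pure, Set.mem_singleton_iff] at h
    subst h
    exact ⟨rfl, rfl, rfl, _, rfl, Or.inl rfl⟩

/-- The transition diagram of a node's loop. -/
lemma phase_step (he : Enabled G s a) (h : s' ∈ (effect H s a).support) (u : V) :
    (a.mover ≠ some u ∧ s'.phase u = s.phase u) ∨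
    (a = .update u ∧ s.phase u = .ready ∧ s'.phase u = .listening) ∨
    (a = .select u ∧ s.phase u = .listening ∧
      (s'.phase u = .ready ∨ ∃ w ∈ NHat H (s.tok u) (s.inbox u), s'.phase u = .proposing w)) ∨
    (∃ w, a = .propose u w ∧ s.phase u = .proposing w ∧
      (s.Engaged w ∧ s'.phase u = .rejected ∨ s'.phase u = .accepted w)) ∨
    (a = .resolve u ∧ (s.phase u = .rejected ∧ s'.phase u = .ready ∨
      ∃ w, s.phase u = .accepted w ∧ s'.phase u = .connected w)) ∨
    (∃ w x y, a = .exchange u w x y ∧ s.phase u = .connected w ∧ s'.phase u = .closing w) ∨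
    (∃ w, a = .close u w ∧ s.phase u = .closing w ∧ s'.phase u = .ready) := by
  by_cases hm : a.mover = some u
  swap
  · refine Or.inl ⟨hm, ?_⟩
    cases a with
    | receive w x => simp only [effect, PMF.support_pure, Set.mem_singleton_iff] at h; subst h; rfl
    | select w =>
      obtain ⟨-, -, -, φ, h, -⟩ := mem_support_effect_select h
      have : u ≠ w := fun e => hm (by simp [Action.mover, e])
      simp [h, this]
    | resolve w =>
      simp only [effect, PMF.support_pure, Set.mem_singleton_iff] at h
      have : u ≠ w := fun e => hm (by simp [Action.mover, e])
      subst h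
      split <;> simp [State.setPhase, this]
    | update w | propose w | exchange w | close w =>
      simp only [effect, PMF.support_pure, Set.mem_singleton_iff] at h
      have : u ≠ w := fun e => hm (by simp [Action.mover, e])
      subst h
      simp [State.setPhase, this]
  · right
    cases a with
    | receive w x => simp [Action.mover] at hm
    | select w =>
      obtain rfl : w = u := by simpa [Action.mover] using hm
      obtain ⟨-, -, -, φ, h, hφ⟩ := mem_support_effect_select h
      refine Or.inr (Or.inl ⟨rfl, he, ?_⟩)
      simpa [h] using hφ
    | resolve w =>
      obtain rfl : w = u := by simpa [Action.mover] using hm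
      simp only [effect, PMF.support_pure, Set.mem_singleton_iff] at h
      refine Or.inr (Or.inr (Or.inr (Or.inl ⟨rfl, ?_⟩)))
      rcases he with he | ⟨x, he⟩
      · rw [he] at h
        subst h
        simp [State.setPhase, he]
      · rw [he] at h
        subst h
        simp [State.setPhase, he]
    | update w =>
      obtain rfl : w = u := by simpa [Action.mover] using hm
      simp only [effect, PMF.support_pure, Set.mem_singleton_iff] at h
      subst h
      exact Or.inl ⟨rfl, he, by simp [State.setPhase]⟩
    | propose w x =>
      obtain rfl : w = u := by simpa [Action.mover] using hm
      simp only [effect, PMF.support_pure, Set.mem_singleton_iff] at h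
      subst h
      refine Or.inr (Or.inr (Or.inl ⟨x, rfl, he, ?_⟩))
      by_cases hE : s.Engaged x <;> simp [State.setPhase, hE]
    | exchange w x y z =>
      obtain rfl : w = u := by simpa [Action.mover] using hm
      simp only [effect, PMF.support_pure, Set.mem_singleton_iff] at h
      subst h
      exact Or.inr (Or.inr (Or.inr (Or.inr
        (Or.inl ⟨x, y, z, rfl, he.1, by simp [State.setPhase]⟩))))
    | close w x =>
      obtain rfl : w = u := by simpa [Action.mover] using hm
      simp only [effect, PMF.support_pure, Set.mem_singleton_iff] at h
      subst h
      exact Or.inr (Or.inr (Or.inr (Or.inr (Or.inr ⟨x, rfl, he, by simp [State.setPhase]⟩))))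

lemma tok_step (h : s' ∈ (effect H s a).support) :
    s'.tok = s.tok ∨ ∃ u w x y, a = .exchange u w x y ∧
      s'.tok = Function.update (Function.update s.tok w (s.tok w ∪ x.toFinset)) u
        (s.tok u ∪ y.toFinset) := by
  cases a with
  | select w => exact Or.inl (mem_support_effect_select h).1
  | exchange u w x y =>
    simp only [effect, PMF.support_pure, Set.mem_singleton_iff] at h
    exact Or.inr ⟨u, w, x, y, rfl, by rw [h]⟩
  | resolve w =>
    simp only [effect, PMF.support_pure, Set.mem_singleton_iff] at h
    subst h
    left
    split <;> rfl
  | update w | propose w | close w | receive w x =>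
    simp only [effect, PMF.support_pure, Set.mem_singleton_iff] at h
    subst h
    exact Or.inl rfl

lemma tok_subset_step (h : s' ∈ (effect H s a).support) (v : V) : s.tok v ⊆ s'.tok v := by
  obtain h | ⟨u, w, x, y, -, h⟩ := tok_step h
  · rw [h]
  · rw [h]
    by_cases hu : v = u
    · subst hu; simp
    · by_cases hw : v = w
      · subst hw; simp [hu]
      · simp [hu, hw]

lemma tok_eq_step (h : s' ∈ (effect H s a).support) {v : V} (ha : ¬ a.ProductiveFor v) :
    s'.tok v = s.tok v := by
  obtain ht | ⟨u, w, x, y, rfl, ht⟩ := tok_step h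
  · rw [ht]
  · simp only [Action.ProductiveFor, not_or, not_and, not_not] at ha
    rw [ht]
    by_cases hu : v = u
    · subst hu; simp [ha.2]
    · by_cases hw : v = w
      · subst hw; simp [hu, ha.1]
      · simp [hu, hw]

lemma tok_subset_of_step (he : Enabled G s a) (h : s' ∈ (effect H s a).support) {U : Finset τ}
    (hU : ∀ v, s.tok v ⊆ U) (v : V) : s'.tok v ⊆ U := by
  obtain ht | ⟨u, w, x, y, rfl, ht⟩ := tok_step h
  · rw [ht]; exact hU v
  · obtain ⟨-, hx, hy⟩ := he
    have key : ∀ (z : Option τ) (w w' : V), Picks (s.tok w \ s.tok w') z → z.toFinset ⊆ U := by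
      rintro (_ | z) w w' hz
      · simp
      · simpa using hU w (Finset.mem_sdiff.1 hz).1
    rw [ht]
    by_cases hu : v = u
    · subst hu; simpa using Finset.union_subset (hU v) (key y _ _ hy)
    · by_cases hw : v = w
      · subst hw; simpa [hu] using Finset.union_subset (hU v) (key x _ _ hx)
      · simpa [hu, hw] using hU v

lemma ad_step (h : s' ∈ (effect H s a).support) (w : V) :
    (a ≠ .update w ∧ s'.ad w = s.ad w) ∨
      (a = .update w ∧ s'.ad w = some ⟨H (s.tok w), (s.tok w).card, w⟩) := by
  cases a with
  | select u => exact Or.inl ⟨by simp, by rw [(mem_support_effect_select h).2.1]⟩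
  | update u =>
    simp only [effect, PMF.support_pure, Set.mem_singleton_iff] at h
    subst h
    by_cases hu : u = w
    · subst hu; simp
    · simp [hu, Ne.symm hu]
  | resolve u =>
    simp only [effect, PMF.support_pure, Set.mem_singleton_iff] at h
    subst h
    refine Or.inl ⟨by simp, ?_⟩
    split <;> rfl
  | exchange u | propose u | close u | receive u x =>
    simp only [effect, PMF.support_pure, Set.mem_singleton_iff] at h
    subst h
    exact Or.inl ⟨by simp, rfl⟩

lemma inbox_step (h : s' ∈ (effect H s a).support) (u : V) :
    (a = .select u ∧ s'.inbox u = ∅) ∨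
      (∃ w, a = .receive u w ∧ s'.inbox u = s.inbox u ∪ {b | s.ad w = some b}) ∨
      (a ≠ .select u ∧ (∀ w, a ≠ .receive u w) ∧ s'.inbox u = s.inbox u) := by
  cases a with
  | select w =>
    have h := (mem_support_effect_select h).2.2.1
    by_cases hu : w = u
    · subst hu; simp [h]
    · simp [h, hu, Ne.symm hu]
  | receive w x =>
    simp only [effect, PMF.support_pure, Set.mem_singleton_iff] at h
    subst h
    by_cases hu : w = u
    · subst hu; simp
    · simp [hu, Ne.symm hu]
  | resolve w =>
    simp only [effect, PMF.support_pure, Set.mem_singleton_iff] at h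
    subst h
    refine Or.inr (Or.inr ⟨by simp, by simp, ?_⟩)
    split <;> rfl
  | exchange w | propose w | close w | update w =>
    simp only [effect, PMF.support_pure, Set.mem_singleton_iff] at h
    subst h
    exact Or.inr (Or.inr ⟨by simp, by simp, rfl⟩)

end Step

end AMTM

namespace AMTM

variable {V τ β : Type*}

/-! ### Timing of a node's loop -/

lemma Params.δMax_pos (p : Params) : 0 < p.δMax := by
  have := p.δUpdate_pos
  have := p.δConn_pos
  have := div_pos p.bMax_pos p.Rb_pos
  unfold Params.δMax
  linarith

lemma Params.δUpdate_le (p : Params) : p.δUpdate ≤ p.δMax := by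
  have := p.δConn_pos
  have := div_pos p.bMax_pos p.Rb_pos
  unfold Params.δMax
  linarith

lemma Params.δConn_le (p : Params) : p.δConn ≤ p.δMax := by
  have := p.δUpdate_pos
  have := div_pos p.bMax_pos p.Rb_pos
  unfold Params.δMax
  linarith

lemma Params.comm_le (p : Params) : 2 * p.bMax / p.Rb ≤ 2 * p.δMax := by
  have := p.δUpdate_pos
  have := p.δConn_pos
  rw [mul_div_assoc]
  unfold Params.δMax
  linarith

/-- The state after the first `k` events of `ρ`. -/
abbrev stateAt (T₀ : V → Finset τ) (ρ : ℕ → Record V τ β) (k : ℕ) : State V τ β :=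
  History.state T₀ (prefixHistory ρ k)

/-- The time of the last of the first `k` events of `ρ`, or `0` if `k = 0`. -/
abbrev clockAt (ρ : ℕ → Record V τ β) (k : ℕ) : ℝ := History.clock (prefixHistory ρ k)

lemma clockAt_succ (ρ : ℕ → Record V τ β) (k : ℕ) : clockAt ρ (k + 1) = (ρ k).time := rfl

variable [Fintype V] [DecidableEq V] [DecidableEq τ]

/-- An infinite sequence of records that obeys the dynamics and the guarantees of the model,
without reference to the adversary that produces it. -/
structure Trajectory (p : Params) (G : SimpleGraph V) (H : Finset τ → β) (T₀ : V → Finset τ)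
    (ρ : ℕ → Record V τ β) : Prop extends Guarantees p G T₀ ρ where
  step : ∀ k, stateAt T₀ ρ (k + 1) ∈ (effect H (stateAt T₀ ρ k) (ρ k).action).support

namespace Trajectory

variable {p : Params} {G : SimpleGraph V} {H : Finset τ → β} {T₀ : V → Finset τ}
  {ρ : ℕ → Record V τ β}

lemma clockAt_mono (h : Trajectory p G H T₀ ρ) : Monotone (clockAt ρ) :=
  monotone_nat_of_le_succ h.mono

lemma time_mono (h : Trajectory p G H T₀ ρ) {i j : ℕ} (hij : i ≤ j) :
    (ρ i).time ≤ (ρ j).time :=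
  h.clockAt_mono (Nat.succ_le_succ hij)

/-- The events up to any given time `B` form an initial segment. -/
lemma exists_cut (h : Trajectory p G H T₀ ρ) {k : ℕ} {B : ℝ} (hk : clockAt ρ k ≤ B) :
    ∃ c, k ≤ c ∧ clockAt ρ c ≤ B ∧ B < (ρ c).time := by
  classical
  have hex : ∃ i, B < (ρ i).time := h.unbounded B
  refine ⟨Nat.find hex, ?_, ?_, Nat.find_spec hex⟩
  · by_contra! hlt
    have h1 := h.clockAt_mono (Nat.succ_le_of_lt hlt)
    rw [Nat.succ_eq_add_one, clockAt_succ] at h1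
    linarith [Nat.find_spec hex]
  · rcases hn : Nat.find hex with _ | m
    · exact (h.clockAt_mono (Nat.zero_le k)).trans hk
    · have := Nat.find_min hex (m := m) (by omega)
      rw [clockAt_succ]
      exact not_lt.1 this

lemma lt_cut (h : Trajectory p G H T₀ ρ) {c i : ℕ} {B : ℝ} (hc : B < (ρ c).time)
    (hi : (ρ i).time ≤ B) : i < c := by
  by_contra! hlt
  linarith [h.time_mono hlt]

/-- A property of states that fails later is destroyed by some event. -/
lemma exists_last {P : ℕ → Prop} {k m : ℕ} (hkm : k ≤ m) (hk : P k) (hm : ¬ P m) :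
    ∃ j, k ≤ j ∧ j < m ∧ P j ∧ ¬ P (j + 1) := by
  by_contra! hcon
  have : ∀ i, k ≤ i → i ≤ m → P i := by
    intro i hi
    induction i, hi using Nat.le_induction with
    | base => exact fun _ => hk
    | succ i hi ih => exact fun him => hcon i hi (by omega) (ih (by omega))
  exact hm (this m hkm le_rfl)

/-- `blockForConn` returns within `δ_max`, counted from any moment at which it is under way. -/
lemma exists_resolve (h : Trajectory p G H T₀ ρ) (u : V) (k : ℕ)
    (hk : (∃ w, (stateAt T₀ ρ k).phase u = .proposing w) ∨
      (stateAt T₀ ρ k).phase u = .rejected ∨ ∃ w, (stateAt T₀ ρ k).phase u = .accepted w) :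
    ∃ m, k ≤ m ∧ (ρ m).action = .resolve u ∧ (ρ m).time ≤ clockAt ρ k + p.δMax := by
  -- `conn_bound` counts from a state with an undelivered proposal; later states of the same call
  -- inherit its bound because the event in between is not the return of the call
  have base : ∀ i w, (stateAt T₀ ρ i).phase u = .proposing w →
      ∃ m, i ≤ m ∧ (ρ m).action = .resolve u ∧ (ρ m).time ≤ clockAt ρ i + p.δMax := by
    intro i w hw
    obtain ⟨m, h1, h2, h3⟩ := h.conn_bound i u w hw
    exact ⟨m, h1, h2, h3.trans (by simpa using p.δConn_le)⟩
  induction k with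
  | zero => simp [stateAt, prefixHistory, History.state, start] at hk
  | succ k ih =>
    rcases hk with ⟨w, hw⟩ | hk
    · exact base _ w hw
    have key : (∃ m, k ≤ m ∧ (ρ m).action = .resolve u ∧
        (ρ m).time ≤ clockAt ρ k + p.δMax) → (ρ k).action ≠ .resolve u →
        ∃ m, k + 1 ≤ m ∧ (ρ m).action = .resolve u ∧
          (ρ m).time ≤ clockAt ρ (k + 1) + p.δMax := by
      rintro ⟨m, h1, h2, h3⟩ hne
      refine ⟨m, ?_, h2, h3.trans (by linarith [h.clockAt_mono (Nat.le_succ k)])⟩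
      rcases h1.eq_or_lt with rfl | h1
      · exact absurd h2 hne
      · exact h1
    rcases phase_step (h.enabled k) (h.step k) u with
      ⟨hm, h1⟩ | ⟨ha, h0, h1⟩ | ⟨ha, h0, h1⟩ | ⟨w, ha, h0, h1⟩ | ⟨ha, h1⟩ |
      ⟨w, x, y, ha, h0, h1⟩ | ⟨w, ha, h0, h1⟩
    · rw [h1] at hk
      exact key (ih (Or.inr hk)) (fun e => hm (by rw [e]; rfl))
    · simp [h1] at hk
    · rcases h1 with h1 | ⟨w, -, h1⟩ <;> simp [h1] at hk
    · exact key (base k w h0) (by simp [ha])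
    · rcases h1 with ⟨-, h1⟩ | ⟨w, -, h1⟩ <;> simp [h1] at hk
    · simp [h1] at hk
    · simp [h1] at hk

/-- `Communicate` returns within `2 δ_max`, counted from any moment at which it is under way. -/
lemma exists_close (h : Trajectory p G H T₀ ρ) (u w : V) (k : ℕ)
    (hk : (stateAt T₀ ρ k).phase u = .connected w ∨ (stateAt T₀ ρ k).phase u = .closing w) :
    ∃ m, k ≤ m ∧ (ρ m).action = .close u w ∧ (ρ m).time ≤ clockAt ρ k + 2 * p.δMax := by
  have base : ∀ i, (stateAt T₀ ρ i).phase u = .connected w →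
      ∃ m, i ≤ m ∧ (ρ m).action = .close u w ∧ (ρ m).time ≤ clockAt ρ i + 2 * p.δMax := by
    intro i hw
    obtain ⟨m, h1, h2, h3⟩ := h.comm_bound i u w hw
    exact ⟨m, h1, h2, h3.trans (by linarith [p.comm_le])⟩
  induction k with
  | zero => simp [stateAt, prefixHistory, History.state, start] at hk
  | succ k ih =>
    rcases hk with hw | hk
    · exact base _ hw
    have key : (∃ m, k ≤ m ∧ (ρ m).action = .close u w ∧
        (ρ m).time ≤ clockAt ρ k + 2 * p.δMax) → (ρ k).action ≠ .close u w →
        ∃ m, k + 1 ≤ m ∧ (ρ m).action = .close u w ∧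
          (ρ m).time ≤ clockAt ρ (k + 1) + 2 * p.δMax := by
      rintro ⟨m, h1, h2, h3⟩ hne
      refine ⟨m, ?_, h2, h3.trans (by linarith [h.clockAt_mono (Nat.le_succ k)])⟩
      rcases h1.eq_or_lt with rfl | h1
      · exact absurd h2 hne
      · exact h1
    rcases phase_step (h.enabled k) (h.step k) u with
      ⟨hm, h1⟩ | ⟨ha, h0, h1⟩ | ⟨ha, h0, h1⟩ | ⟨w', ha, h0, h1⟩ | ⟨ha, h1⟩ |
      ⟨w', x, y, ha, h0, h1⟩ | ⟨w', ha, h0, h1⟩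
    · rw [h1] at hk
      exact key (ih (Or.inr hk)) (fun e => hm (by rw [e]; rfl))
    · simp [h1] at hk
    · rcases h1 with h1 | ⟨w, -, h1⟩ <;> simp [h1] at hk
    · rcases h1 with ⟨-, h1⟩ | h1 <;> simp [h1] at hk
    · rcases h1 with ⟨-, h1⟩ | ⟨w, -, h1⟩ <;> simp [h1] at hk
    · obtain rfl : w' = w := by simpa [h1] using hk
      exact key (base k h0) (by simp [ha])
    · simp [h1] at hk

/-- From any moment on, every node is back at the top of its loop within `4 δ_max`. -/
lemma exists_ready (h : Trajectory p G H T₀ ρ) (k : ℕ) (u : V) :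
    ∃ j, k ≤ j ∧ (stateAt T₀ ρ j).phase u = .ready ∧ clockAt ρ j ≤ clockAt ρ k + 4 * p.δMax := by
  have hp := p.δMax_pos
  have comm : ∀ k w, ((stateAt T₀ ρ k).phase u = .connected w ∨
      (stateAt T₀ ρ k).phase u = .closing w) → ∃ j, k ≤ j ∧
      (stateAt T₀ ρ j).phase u = .ready ∧ clockAt ρ j ≤ clockAt ρ k + 2 * p.δMax := by
    intro k w hk
    obtain ⟨m, h1, h2, h3⟩ := h.exists_close u w k hk
    refine ⟨m + 1, by omega, ?_, h3⟩
    rcases phase_step (h.enabled m) (h.step m) u with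
      ⟨hm, h1⟩ | ⟨ha, h0, h1⟩ | ⟨ha, h0, h1⟩ | ⟨w', ha, h0, h1⟩ | ⟨ha, h1⟩ |
      ⟨w', x, y, ha, h0, h1⟩ | ⟨w', ha, h0, h1⟩
    · exact absurd (by rw [h2]; rfl) hm
    all_goals first | exact h1 | simp [h2] at ha
  have conn : ∀ k, ((∃ w, (stateAt T₀ ρ k).phase u = .proposing w) ∨
      (stateAt T₀ ρ k).phase u = .rejected ∨ ∃ w, (stateAt T₀ ρ k).phase u = .accepted w) →
      ∃ j, k ≤ j ∧ (stateAt T₀ ρ j).phase u = .ready ∧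
        clockAt ρ j ≤ clockAt ρ k + 3 * p.δMax := by
    intro k hk
    obtain ⟨m, h1, h2, h3⟩ := h.exists_resolve u k hk
    rw [← clockAt_succ] at h3
    rcases phase_step (h.enabled m) (h.step m) u with
      ⟨hm, h1⟩ | ⟨ha, h0, h1⟩ | ⟨ha, h0, h1⟩ | ⟨w', ha, h0, h1⟩ | ⟨ha, h5⟩ |
      ⟨w', x, y, ha, h0, h1⟩ | ⟨w', ha, h0, h1⟩
    · exact absurd (by rw [h2]; rfl) hm
    all_goals try simp [h2] at ha
    rcases h5 with ⟨-, h5⟩ | ⟨w, -, h5⟩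
    · exact ⟨m + 1, by omega, h5, by linarith⟩
    · obtain ⟨j, hj, hr, hc⟩ := comm (m + 1) w (Or.inl h5)
      exact ⟨j, by omega, hr, by linarith⟩
  cases hph : (stateAt T₀ ρ k).phase u with
  | ready => exact ⟨k, le_rfl, hph, by linarith⟩
  | listening =>
    obtain ⟨m, h1, h2, h3⟩ := h.receive_bound k u hph
    rw [← clockAt_succ] at h3
    change _ ≤ clockAt ρ k + _ at h3
    rcases phase_step (h.enabled m) (h.step m) u with
      ⟨hm, h1⟩ | ⟨ha, h0, h1⟩ | ⟨ha, h0, h5⟩ | ⟨w', ha, h0, h1⟩ | ⟨ha, h1⟩ |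
      ⟨w', x, y, ha, h0, h1⟩ | ⟨w', ha, h0, h1⟩
    · exact absurd (by rw [h2]; rfl) hm
    all_goals try simp [h2] at ha
    rcases h5 with h5 | ⟨w, -, h5⟩
    · exact ⟨m + 1, by omega, h5, by linarith⟩
    · obtain ⟨j, hj, hr, hc⟩ := conn (m + 1) (Or.inl ⟨w, h5⟩)
      exact ⟨j, by omega, hr, by linarith⟩
  | proposing w =>
    obtain ⟨j, hj, hr, hc⟩ := conn k (Or.inl ⟨w, hph⟩)
    exact ⟨j, hj, hr, by linarith⟩
  | rejected =>
    obtain ⟨j, hj, hr, hc⟩ := conn k (Or.inr (Or.inl hph))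
    exact ⟨j, hj, hr, by linarith⟩
  | accepted w =>
    obtain ⟨j, hj, hr, hc⟩ := conn k (Or.inr (Or.inr ⟨w, hph⟩))
    exact ⟨j, hj, hr, by linarith⟩
  | connected w =>
    obtain ⟨j, hj, hr, hc⟩ := comm k w (Or.inl hph)
    exact ⟨j, hj, hr, by linarith⟩
  | closing w =>
    obtain ⟨j, hj, hr, hc⟩ := comm k w (Or.inr hph)
    exact ⟨j, hj, hr, by linarith⟩

lemma exists_update (h : Trajectory p G H T₀ ρ) (k : ℕ) (u : V) :
    ∃ j, k ≤ j ∧ (ρ j).action = .update u ∧ (ρ j).time ≤ clockAt ρ k + 5 * p.δMax := by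
  obtain ⟨j, hj, hr, hc⟩ := h.exists_ready k u
  obtain ⟨m, h1, h2, h3⟩ := h.update_bound j u hr
  change _ ≤ clockAt ρ j + _ at h3
  exact ⟨m, hj.trans h1, h2, by linarith [p.δUpdate_le]⟩

lemma exists_select (h : Trajectory p G H T₀ ρ) (k : ℕ) (u : V) :
    ∃ j, k ≤ j ∧ (ρ j).action = .select u ∧ (ρ j).time ≤ clockAt ρ k + 6 * p.δMax := by
  obtain ⟨j, hj, ha, hc⟩ := h.exists_update k u
  rw [← clockAt_succ] at hc
  have hl : (stateAt T₀ ρ (j + 1)).phase u = .listening := by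
    rcases phase_step (h.enabled j) (h.step j) u with
      ⟨hm, h1⟩ | ⟨ha', h0, h1⟩ | ⟨ha', h0, h5⟩ | ⟨w', ha', h0, h1⟩ | ⟨ha', h1⟩ |
      ⟨w', x, y, ha', h0, h1⟩ | ⟨w', ha', h0, h1⟩
    · exact absurd (by rw [ha]; rfl) hm
    · exact h1
    all_goals simp [ha] at ha'
  obtain ⟨m, h1, h2, h3⟩ := h.receive_bound (j + 1) u hl
  change _ ≤ clockAt ρ (j + 1) + _ at h3
  exact ⟨m, by omega, h2, by linarith⟩

/-- A connection that has been accepted or opened leads to its token transfer within `3 δ_max`. -/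
lemma exists_exchange (h : Trajectory p G H T₀ ρ) (u w : V) (k : ℕ)
    (hk : (stateAt T₀ ρ k).phase u = .accepted w ∨ (stateAt T₀ ρ k).phase u = .connected w) :
    ∃ j, k ≤ j ∧ (ρ j).time ≤ clockAt ρ k + 3 * p.δMax ∧
      ∃ x y, (ρ j).action = .exchange u w x y := by
  have hp := p.δMax_pos
  have comm : ∀ k, (stateAt T₀ ρ k).phase u = .connected w →
      ∃ j, k ≤ j ∧ (ρ j).time ≤ clockAt ρ k + 2 * p.δMax ∧
        ∃ x y, (ρ j).action = .exchange u w x y := by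
    intro k hk
    obtain ⟨m, h1, h2, h3⟩ := h.exists_close u w k (Or.inl hk)
    have hm : ¬ (stateAt T₀ ρ m).phase u = .connected w := by
      have := h.enabled m
      rw [h2] at this
      change (stateAt T₀ ρ m).phase u = _ at this
      simp [this]
    obtain ⟨j, hkj, hjm, hj, hj'⟩ :=
      exists_last (P := fun i => (stateAt T₀ ρ i).phase u = .connected w) h1 hk hm
    refine ⟨j, hkj, (h.time_mono hjm.le).trans h3, ?_⟩
    rcases phase_step (h.enabled j) (h.step j) u with
      ⟨hm, h1⟩ | ⟨ha', h0, h1⟩ | ⟨ha', h0, h5⟩ | ⟨w', ha', h0, h1⟩ | ⟨ha', h1⟩ |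
      ⟨w', x, y, ha', h0, h1⟩ | ⟨w', ha', h0, h1⟩
    · exact absurd (h1.trans hj) hj'
    · simp [h0] at hj
    · simp [h0] at hj
    · simp [h0] at hj
    · rcases h1 with ⟨h0, -⟩ | ⟨w, h0, -⟩ <;> simp [h0] at hj
    · obtain rfl : w' = w := by simpa [h0] using hj
      exact ⟨x, y, ha'⟩
    · simp [h0] at hj
  rcases hk with hk | hk
  · obtain ⟨m, h1, h2, h3⟩ := h.exists_resolve u k (Or.inr (Or.inr ⟨w, hk⟩))
    have hm : ¬ (stateAt T₀ ρ (m + 1)).phase u = .accepted w := by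
      rcases phase_step (h.enabled m) (h.step m) u with
        ⟨hm, h1⟩ | ⟨ha', h0, h1⟩ | ⟨ha', h0, h5⟩ | ⟨w', ha', h0, h1⟩ | ⟨ha', h1⟩ |
        ⟨w', x, y, ha', h0, h1⟩ | ⟨w', ha', h0, h1⟩
      · exact absurd (by rw [h2]; rfl) hm
      all_goals try simp [h2] at ha'
      rcases h1 with ⟨-, h0⟩ | ⟨w, -, h0⟩ <;> simp [h0]
    obtain ⟨j, hkj, hjm, hj, hj'⟩ :=
      exists_last (P := fun i => (stateAt T₀ ρ i).phase u = .accepted w) (by omega) hk hm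
    have hc : (stateAt T₀ ρ (j + 1)).phase u = .connected w := by
      rcases phase_step (h.enabled j) (h.step j) u with
        ⟨hm, h1⟩ | ⟨ha', h0, h1⟩ | ⟨ha', h0, h5⟩ | ⟨w', ha', h0, h1⟩ | ⟨ha', h1⟩ |
        ⟨w', x, y, ha', h0, h1⟩ | ⟨w', ha', h0, h1⟩
      · exact absurd (h1.trans hj) hj'
      · simp [h0] at hj
      · simp [h0] at hj
      · simp [h0] at hj
      · rcases h1 with ⟨h0, -⟩ | ⟨w', h0, h1⟩
        · simp [h0] at hj
        · obtain rfl : w' = w := by simpa [h0] using hj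
          exact h1
      · simp [h0] at hj
      · simp [h0] at hj
    obtain ⟨i, hi, hit, hx⟩ := comm (j + 1) hc
    refine ⟨i, by omega, ?_, hx⟩
    have := h.time_mono (Nat.le_of_lt_succ hjm)
    rw [clockAt_succ] at hit
    linarith
  · obtain ⟨i, hi, hit, hx⟩ := comm k hk
    exact ⟨i, by omega, by linarith, hx⟩

/-- A node that is proposing to `w` sees its proposal delivered within `δ_max`. -/
lemma exists_propose (h : Trajectory p G H T₀ ρ) (u w : V) (k : ℕ)
    (hk : (stateAt T₀ ρ k).phase u = .proposing w) :
    ∃ j, k ≤ j ∧ (ρ j).time ≤ clockAt ρ k + p.δMax ∧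
      ((stateAt T₀ ρ j).Engaged w ∨ (stateAt T₀ ρ (j + 1)).phase u = .accepted w) := by
  obtain ⟨m, h1, h2, h3⟩ := h.exists_resolve u k (Or.inl ⟨w, hk⟩)
  have hm : ¬ (stateAt T₀ ρ m).phase u = .proposing w := by
    have := h.enabled m
    rw [h2] at this
    rcases this with this | ⟨x, this⟩ <;> · change (stateAt T₀ ρ m).phase u = _ at this; simp [this]
  obtain ⟨j, hkj, hjm, hj, hj'⟩ :=
    exists_last (P := fun i => (stateAt T₀ ρ i).phase u = .proposing w) h1 hk hm
  refine ⟨j, hkj, (h.time_mono hjm.le).trans h3, ?_⟩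
  rcases phase_step (h.enabled j) (h.step j) u with
    ⟨hm, h1⟩ | ⟨ha', h0, h1⟩ | ⟨ha', h0, h5⟩ | ⟨w', ha', h0, h1⟩ | ⟨ha', h1⟩ |
    ⟨w', x, y, ha', h0, h1⟩ | ⟨w', ha', h0, h1⟩
  · exact absurd (h1.trans hj) hj'
  · simp [h0] at hj
  · simp [h0] at hj
  · obtain rfl : w' = w := by simpa [h0] using hj
    exact h1.imp And.left id
  · rcases h1 with ⟨h0, -⟩ | ⟨w', h0, h1⟩ <;> simp [h0] at hj
  · simp [h0] at hj
  · simp [h0] at hj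

end Trajectory

end AMTM

namespace AMTM

variable {V τ β : Type*}
variable [Fintype V] [DecidableEq V] [DecidableEq τ]

namespace Trajectory

variable {p : Params} {G : SimpleGraph V} {H : Finset τ → β} {T₀ : V → Finset τ}
  {ρ : ℕ → Record V τ β}

/-! ### Fresh advertisements and safe connections -/

/-- None of the events `n, …, k - 1` gives `v` a new token. -/
def Quiet (ρ : ℕ → Record V τ β) (v : V) (n k : ℕ) : Prop :=
  ∀ i, n ≤ i → i < k → ¬ (ρ i).action.ProductiveFor v

/-- The advertisement describes a token set that its sender had at some state between the `n`-th
and the `k`-th. -/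
def FreshAd (H : Finset τ → β) (T₀ : V → Finset τ) (ρ : ℕ → Record V τ β) (n k : ℕ)
    (a : Ad V β) : Prop :=
  ∃ i, n ≤ i ∧ i ≤ k ∧ a.hash = H ((stateAt T₀ ρ i).tok a.sender) ∧
    a.size = ((stateAt T₀ ρ i).tok a.sender).card

/-- If `u` has a connection to `v` in preparation or open, then the token transfer of that
connection is still to come, and `u` knows a token that `v` lacks. -/
def SafeFor (s : State V τ β) (v u : V) : Prop :=
  ((s.phase u = .proposing v ∨ s.phase u = .accepted v ∨ s.phase u = .connected v) →
    ¬ s.tok u ⊆ s.tok v) ∧ s.phase u ≠ .closing v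

omit [Fintype V] [DecidableEq V] [DecidableEq τ] in
lemma Quiet.mono {v : V} {n k k' : ℕ} (h : Quiet ρ v n k) (hk : k' ≤ k) : Quiet ρ v n k' :=
  fun i h1 h2 => h i h1 (by omega)

omit [Fintype V] [DecidableEq V] [DecidableEq τ] in
lemma FreshAd.mono {n k k' : ℕ} {a : Ad V β} (h : FreshAd H T₀ ρ n k a) (hk : k ≤ k') :
    FreshAd H T₀ ρ n k' a := by
  obtain ⟨i, h1, h2, h3⟩ := h
  exact ⟨i, h1, h2.trans hk, h3⟩

lemma tok_mono (h : Trajectory p G H T₀ ρ) (w : V) :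
    Monotone fun k => (stateAt T₀ ρ k).tok w :=
  monotone_nat_of_le_succ fun k => tok_subset_step (h.step k) w

lemma tok_eq_of_quiet (h : Trajectory p G H T₀ ρ) {v : V} {n k i : ℕ} (hq : Quiet ρ v n k)
    (hn : n ≤ i) (hi : i ≤ k) : (stateAt T₀ ρ i).tok v = (stateAt T₀ ρ n).tok v := by
  induction i, hn using Nat.le_induction with
  | base => rfl
  | succ i hni ih => rw [tok_eq_step (h.step i) (hq i hni (by omega)), ih (by omega)]

lemma tok_subset_biUnion (h : Trajectory p G H T₀ ρ) (k : ℕ) :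
    ∀ w, (stateAt T₀ ρ k).tok w ⊆ Finset.univ.biUnion T₀ := by
  induction k with
  | zero => exact fun w => Finset.subset_biUnion_of_mem T₀ (Finset.mem_univ w)
  | succ k ih => exact tok_subset_of_step (h.enabled k) (h.step k) ih

variable {n : ℕ} {t₁ : ℝ}

lemma exists_freshAd (h : Trajectory p G H T₀ ρ) (ht : clockAt ρ n ≤ t₁) {k : ℕ}
    (hk : t₁ + 5 * p.δMax < (ρ k).time) (w : V) :
    ∃ a, (stateAt T₀ ρ k).ad w = some a ∧ a.sender = w ∧ FreshAd H T₀ ρ n k a := by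
  obtain ⟨j, hnj, ha, hj⟩ := h.exists_update n w
  have hjk : j + 1 ≤ k := h.lt_cut hk (by linarith)
  clear hk
  induction k, hjk using Nat.le_induction with
  | base =>
    obtain ⟨h1, -⟩ | ⟨-, h1⟩ := ad_step (h.step j) w
    · exact absurd ha h1
    · exact ⟨_, h1, rfl, j, hnj, by omega, rfl, rfl⟩
  | succ k hjk ih =>
    obtain ⟨-, h1⟩ | ⟨-, h1⟩ := ad_step (h.step k) w
    · obtain ⟨a, h2, h3, h4⟩ := ih
      exact ⟨a, h1.trans h2, h3, h4.mono (by omega)⟩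
    · exact ⟨_, h1, rfl, k, by omega, by omega, rfl, rfl⟩

lemma inbox_fresh (h : Trajectory p G H T₀ ρ) (ht : clockAt ρ n ≤ t₁) {k : ℕ}
    (hk : t₁ + 11 * p.δMax < (ρ k).time) (u : V) :
    ∀ a ∈ (stateAt T₀ ρ k).inbox u, FreshAd H T₀ ρ n k a ∧ G.Adj a.sender u := by
  have hp := p.δMax_pos
  obtain ⟨c, hnc, hc, hc'⟩ := h.exists_cut (k := n) (B := t₁ + 5 * p.δMax) (by linarith)
  obtain ⟨j, hcj, ha, hj⟩ := h.exists_select c u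
  have hjk : j + 1 ≤ k := h.lt_cut hk (by linarith)
  clear hk
  induction k, hjk using Nat.le_induction with
  | base =>
    obtain ⟨-, h1⟩ | ⟨w, h1, -⟩ | ⟨h1, -⟩ := inbox_step (h.step j) u
    · rw [h1]; simp
    · simp [ha] at h1
    · exact absurd ha h1
  | succ k hjk ih =>
    obtain ⟨-, h1⟩ | ⟨w, h0, h1⟩ | ⟨-, -, h1⟩ := inbox_step (h.step k) u
    · rw [h1]; simp
    · rw [h1]
      rintro a (ha | ha)
      · exact ⟨(ih a ha).1.mono (by omega), (ih a ha).2⟩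
      · obtain ⟨b, h2, h3, h4⟩ := h.exists_freshAd (k := k) ht
          (hc'.trans_le (h.time_mono (by omega))) w
        obtain rfl : b = a := by
          rw [Set.mem_ofPred_eq] at ha
          exact Option.some_injective _ (h2.symm.trans ha)
        have he := h.enabled k
        rw [h0] at he
        exact ⟨h4.mono (by omega), h3 ▸ he.1⟩
    · rw [h1]
      exact fun a ha => ⟨(ih a ha).1.mono (by omega), (ih a ha).2⟩

variable {v : V}

/-- Whoever selects `v` on the basis of fresh advertisements knows a token that `v` lacks,
because `v` has the smallest token set. -/
lemma not_subset_of_mem_NHat (h : Trajectory p G H T₀ ρ) (ht : clockAt ρ n ≤ t₁)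
    (hv : v ∈ Smin (stateAt T₀ ρ n).tok) {k : ℕ} (hnk : n ≤ k)
    (hk : t₁ + 11 * p.δMax < (ρ k).time)
    (hq : Quiet ρ v n k) {u : V}
    (hN : v ∈ NHat H ((stateAt T₀ ρ k).tok u) ((stateAt T₀ ρ k).inbox u)) :
    ¬ (stateAt T₀ ρ k).tok u ⊆ (stateAt T₀ ρ k).tok v := by
  intro hsub
  simp only [NHat, Finset.mem_filter, Finset.mem_univ, true_and] at hN
  obtain ⟨a, ha, hne, -, rfl⟩ := hN
  obtain ⟨⟨i, hni, hik, hi, -⟩, -⟩ := h.inbox_fresh ht hk u a ha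
  rw [h.tok_eq_of_quiet hq hni hik] at hi
  rw [h.tok_eq_of_quiet hq hnk le_rfl] at hsub
  have hcard := (hv u).trans (Finset.card_le_card (h.tok_mono u hnk))
  rw [← Finset.eq_of_subset_of_card_le hsub hcard] at hi
  exact hne hi

lemma safeFor (h : Trajectory p G H T₀ ρ) (ht : clockAt ρ n ≤ t₁)
    (hv : v ∈ Smin (stateAt T₀ ρ n).tok) {k : ℕ} (hk : t₁ + 15 * p.δMax < (ρ k).time)
    (hq : Quiet ρ v n k) (u : V) : SafeFor (stateAt T₀ ρ k) v u := by
  have hp := p.δMax_pos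
  obtain ⟨c, hnc, hc, hc'⟩ := h.exists_cut (k := n) (B := t₁ + 11 * p.δMax) (by linarith)
  obtain ⟨j, hcj, hr, hj⟩ := h.exists_ready c u
  have hjk : j ≤ k := by
    by_contra! hlt
    have := h.clockAt_mono (Nat.succ_le_of_lt hlt)
    rw [Nat.succ_eq_add_one, clockAt_succ] at this
    linarith
  clear hk
  induction k, hjk using Nat.le_induction with
  | base => simp [SafeFor, hr]
  | succ k hjk ih =>
    have hk : t₁ + 11 * p.δMax < (ρ k).time := hc'.trans_le (h.time_mono (by omega))
    have ih := ih (hq.mono (by omega))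
    have htv : (stateAt T₀ ρ (k + 1)).tok v = (stateAt T₀ ρ k).tok v :=
      tok_eq_step (h.step k) (hq k (by omega) (by omega))
    have htu := tok_subset_step (h.step k) u
    have key : ¬ (stateAt T₀ ρ k).tok u ⊆ (stateAt T₀ ρ k).tok v →
        ¬ (stateAt T₀ ρ (k + 1)).tok u ⊆ (stateAt T₀ ρ (k + 1)).tok v :=
      fun h1 h2 => h1 (htu.trans (by rwa [htv] at h2))
    rcases phase_step (h.enabled k) (h.step k) u with
      ⟨hm, h1⟩ | ⟨ha, h0, h1⟩ | ⟨ha, h0, h1⟩ | ⟨w, ha, h0, h1⟩ | ⟨ha, h1⟩ |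
      ⟨w, x, y, ha, h0, h1⟩ | ⟨w, ha, h0, h1⟩
    · unfold SafeFor
      rw [h1]
      exact ⟨fun hh => key (ih.1 hh), ih.2⟩
    · simp [SafeFor, h1]
    · rcases h1 with h1 | ⟨w, hw, h1⟩
      · simp [SafeFor, h1]
      · refine ⟨fun hh => key ?_, by simp [h1]⟩
        obtain rfl : w = v := by simpa [h1] using hh
        exact h.not_subset_of_mem_NHat ht hv (by omega) hk (hq.mono (by omega)) hw
    · rcases h1 with ⟨-, h1⟩ | h1
      · simp [SafeFor, h1]
      · refine ⟨fun hh => key (ih.1 ?_), by simp [h1]⟩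
        obtain rfl : w = v := by simpa [h1] using hh
        exact Or.inl h0
    · rcases h1 with ⟨-, h1⟩ | ⟨w, h0, h1⟩
      · simp [SafeFor, h1]
      · refine ⟨fun hh => key (ih.1 ?_), by simp [h1]⟩
        obtain rfl : w = v := by simpa [h1] using hh
        exact Or.inr (Or.inl h0)
    -- a transfer to `v` from a safe node would be productive
    · have hwv : w ≠ v := by
        rintro rfl
        have he := h.enabled k
        rw [ha] at he
        refine hq k (by omega) (by omega) ?_
        rw [ha]
        exact productiveFor_of_enabled_exchange he (ih.1 (Or.inr (Or.inr h0)))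
      simp [SafeFor, h1, hwv]
    · simp [SafeFor, h1]

/-- Once stale connections are gone, a node that selects `v` brings about a productive connection
of `v`: its own, or the open one because of which `v` rejects it. -/
lemma exists_productive_of_proposing (h : Trajectory p G H T₀ ρ) (ht : clockAt ρ n ≤ t₁)
    (hv : v ∈ Smin (stateAt T₀ ρ n).tok) {k : ℕ} (hnk : n ≤ k)
    (hk : t₁ + 15 * p.δMax < (ρ k).time) {u : V}
    (hu : (stateAt T₀ ρ (k + 1)).phase u = .proposing v) :
    ∃ i, n ≤ i ∧ (ρ i).action.ProductiveFor v ∧ (ρ i).time ≤ (ρ k).time + 4 * p.δMax := by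
  have hp := p.δMax_pos
  by_contra! hcon
  have quiet : ∀ j, (ρ j).time ≤ (ρ k).time + 4 * p.δMax → Quiet ρ v n (j + 1) :=
    fun j hj i hi hij hpi => by
      linarith [hcon i hi hpi, h.time_mono (Nat.le_of_lt_succ hij)]
  -- a connection to `v` that is accepted or open early enough is productive
  have main : ∀ j u', k ≤ j → clockAt ρ (j + 1) ≤ (ρ k).time + p.δMax →
      ((stateAt T₀ ρ (j + 1)).phase u' = .accepted v ∨
        (stateAt T₀ ρ (j + 1)).phase u' = .connected v) → False := by
    intro j u' hkj hj hph
    obtain ⟨i, hji, hi, x, y, ha⟩ := h.exists_exchange u' v (j + 1) hph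
    have hq := quiet i (by linarith)
    have hs := h.safeFor ht hv (hk.trans_le (h.time_mono (by omega : k ≤ i)))
      (hq.mono (Nat.le_succ i)) u'
    have he := h.enabled i
    rw [ha] at he
    refine hq i (by omega) (by omega) ?_
    rw [ha]
    exact productiveFor_of_enabled_exchange he (hs.1 (Or.inr (Or.inr he.1)))
  obtain ⟨j, hkj, hj, hE⟩ := h.exists_propose u v (k + 1) hu
  rw [clockAt_succ] at hj
  rcases hE with ⟨u', hu'⟩ | hacc
  -- the proposal is rejected: the connection that engages `v` is productive
  · have hs := h.safeFor ht hv (hk.trans_le (h.time_mono (by omega : k ≤ j)))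
      ((quiet j (by linarith)).mono (Nat.le_succ j)) u'
    obtain ⟨i, rfl⟩ : ∃ i, j = i + 1 := ⟨j - 1, by omega⟩
    have hi : clockAt ρ (i + 1) ≤ (ρ k).time + p.δMax := (h.mono (i + 1)).trans hj
    rcases hu' with hu' | hu' | hu'
    · exact main i u' (by omega) hi (Or.inl hu')
    · exact main i u' (by omega) hi (Or.inr hu')
    · exact hs.2 hu'
  · exact main j u (by omega) hj (Or.inl hacc)

/-- Unless `v` connects productively, each neighbour `u` with a larger token set makes a selection
in which `v` is a candidate and all other candidates are neighbours of `u` of minimum size. -/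
lemma exists_qualified_select (h : Trajectory p G H T₀ ρ) (ht : clockAt ρ n ≤ t₁)
    (hinj : Set.InjOn H {S | S ⊆ Finset.univ.biUnion T₀})
    (hv : v ∈ Smin (stateAt T₀ ρ n).tok) {u : V} (huv : G.Adj v u)
    (hu : u ∉ Smin (stateAt T₀ ρ n).tok) :
    (∃ i, n ≤ i ∧ (ρ i).action.ProductiveFor v ∧ (ρ i).time ≤ t₁ + 27 * p.δMax) ∨
    ∃ k, n ≤ k ∧ (ρ k).action = .select u ∧ t₁ + 15 * p.δMax < (ρ k).time ∧
      (ρ k).time ≤ t₁ + 27 * p.δMax ∧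
      v ∈ NHat H ((stateAt T₀ ρ k).tok u) ((stateAt T₀ ρ k).inbox u) ∧
      ∀ w ∈ NHat H ((stateAt T₀ ρ k).tok u) ((stateAt T₀ ρ k).inbox u),
        G.Adj w u ∧ w ∈ Smin (stateAt T₀ ρ n).tok := by
  classical
  have hp := p.δMax_pos
  rw [or_iff_not_imp_left]
  intro hcon
  push Not at hcon
  have quiet : ∀ j, (ρ j).time ≤ t₁ + 27 * p.δMax → Quiet ρ v n (j + 1) :=
    fun j hj i hi hij hpi => by
      linarith [hcon i hi hpi, h.time_mono (Nat.le_of_lt_succ hij)]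
  obtain ⟨c, hnc, hc, hc'⟩ := h.exists_cut (k := n) (B := t₁ + 15 * p.δMax) (by linarith)
  obtain ⟨j, hcj, haj, hj⟩ := h.exists_update c v
  obtain ⟨m, hjm, ham, hm⟩ := h.ad_bound j v u haj huv
  have hm : (ρ m).time ≤ t₁ + 21 * p.δMax := by linarith [p.δUpdate_le]
  have hsel : ∃ q, m + 1 ≤ q ∧ (ρ q).action = .select u ∧
      (ρ q).time ≤ clockAt ρ (m + 1) + 6 * p.δMax := h.exists_select (m + 1) u
  -- the first selection of `u` after the advertisement of `v` has arrived
  obtain ⟨hmq, haq, hq⟩ := Nat.find_spec hsel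
  have hfirst : ∀ i, m + 1 ≤ i → i < Nat.find hsel → (ρ i).action ≠ .select u :=
    fun i hi hiq ha => Nat.find_min hsel hiq ⟨hi, ha, (h.time_mono hiq.le).trans hq⟩
  generalize Nat.find hsel = q at hmq haq hq hfirst
  rw [clockAt_succ] at hq
  have hqT : (ρ q).time ≤ t₁ + 27 * p.δMax := by linarith
  have hQ : Quiet ρ v n q := (quiet q hqT).mono (Nat.le_succ q)
  have late : ∀ i, c ≤ i → t₁ + 15 * p.δMax < (ρ i).time :=
    fun i hi => hc'.trans_le (h.time_mono hi)
  obtain ⟨a, had, hav, i₀, hni₀, hi₀m, hhash, hsize⟩ :=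
    h.exists_freshAd (k := m) ht (by linarith [late m (by omega)]) v
  rw [hav, h.tok_eq_of_quiet hQ hni₀ (by omega)] at hhash hsize
  have hin : a ∈ (stateAt T₀ ρ q).inbox u := by
    clear haq hq hqT hQ
    induction q, hmq using Nat.le_induction with
    | base =>
      obtain ⟨h1, -⟩ | ⟨w, h0, h1⟩ | ⟨-, h1, -⟩ := inbox_step (h.step m) u
      · simp [ham] at h1
      · obtain rfl : v = w := by simpa [ham] using h0
        rw [h1]
        exact Or.inr had
      · exact absurd ham (h1 v)
    | succ q hmq ih =>
      have ih := ih fun i hi hiq => hfirst i hi (by omega)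
      obtain ⟨h1, -⟩ | ⟨w, h0, h1⟩ | ⟨-, -, h1⟩ := inbox_step (h.step q) u
      · exact absurd h1 (hfirst q hmq (by omega))
      · rw [h1]; exact Or.inl ih
      · rw [h1]; exact ih
  have hinbox := h.inbox_fresh ht (k := q) (by linarith [late q (by omega)]) u
  -- every advertised size is at least the minimum at state `n`
  have hge : ∀ b ∈ (stateAt T₀ ρ q).inbox u,
      ((stateAt T₀ ρ n).tok b.sender).card ≤ b.size := by
    intro b hb
    obtain ⟨⟨i, hi, -, -, hbs⟩, -⟩ := hinbox b hb
    rw [hbs]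
    exact Finset.card_le_card (h.tok_mono _ hi)
  have hlt : ((stateAt T₀ ρ n).tok v).card < ((stateAt T₀ ρ q).tok u).card := by
    simp only [Smin, Set.mem_ofPred_eq, not_forall, not_le] at hu
    obtain ⟨w, hw⟩ := hu
    exact ((hv w).trans_lt hw).trans_le (Finset.card_le_card (h.tok_mono u (by omega)))
  have hne : a.hash ≠ H ((stateAt T₀ ρ q).tok u) := by
    rw [hhash]
    intro he
    have := hinj (h.tok_subset_biUnion n v) (h.tok_subset_biUnion q u) he
    rw [this] at hlt
    exact lt_irrefl _ hlt
  have hsHat : sHat H ((stateAt T₀ ρ q).tok u) ((stateAt T₀ ρ q).inbox u) =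
      ((stateAt T₀ ρ n).tok v).card := by
    apply le_antisymm
    · exact Nat.sInf_le ⟨a, hin, hne, hsize⟩
    · refine le_csInf ⟨_, a, hin, hne, rfl⟩ ?_
      rintro s ⟨b, hb, -, rfl⟩
      exact (hv _).trans (hge b hb)
  refine ⟨q, by omega, haq, late q (by omega), hqT, ?_, ?_⟩
  · simp only [NHat, Finset.mem_filter, Finset.mem_univ, true_and, hsHat]
    exact ⟨a, hin, hne, hsize, hav⟩
  · intro w hw
    simp only [NHat, Finset.mem_filter, Finset.mem_univ, true_and, hsHat] at hw
    obtain ⟨b, hb, -, hbs, rfl⟩ := hw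
    refine ⟨(hinbox b hb).2, fun x => ?_⟩
    have := hge b hb
    rw [hbs] at this
    exact this.trans (hv x)

end Trajectory

end AMTM

namespace AMTM

variable {V τ β : Type*}

/-! ### Histories and the executions that extend them -/

lemma length_prefixHistory (ρ : ℕ → Record V τ β) (k : ℕ) : (prefixHistory ρ k).length = k := by
  induction k with
  | zero => rfl
  | succ k ih => simp [prefixHistory, ih]

lemma prefixHistory_eq_of_le {ρ ρ' : ℕ → Record V τ β} {n k : ℕ} (hnk : n ≤ k)
    (h : prefixHistory ρ k = prefixHistory ρ' k) : prefixHistory ρ n = prefixHistory ρ' n := by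
  induction k, hnk using Nat.le_induction with
  | base => exact h
  | succ k _ ih => exact ih (List.cons.inj h).2

lemma prefixHistory_length_of_append {ρ : ℕ → Record V τ β} {new g : History V τ β}
    (h : prefixHistory ρ (new ++ g).length = new ++ g) : prefixHistory ρ g.length = g := by
  induction new with
  | nil => exact h
  | cons r new ih => exact ih (List.cons.inj h).2

lemma mem_of_prefixHistory_eq_append {ρ : ℕ → Record V τ β} {new g : History V τ β}
    (h : prefixHistory ρ (new ++ g).length = new ++ g) {i : ℕ} (hi : g.length ≤ i)
    (hi' : i < (new ++ g).length) : ρ i ∈ new := by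
  induction new with
  | nil => exact absurd hi (not_le.2 hi')
  | cons r new ih =>
    obtain ⟨h1, h2⟩ := List.cons.inj h
    simp only [List.cons_append, List.length_cons] at hi'
    rcases (Nat.le_of_lt_succ hi').eq_or_lt with rfl | hlt
    · exact List.mem_cons.2 (Or.inl h1)
    · exact List.mem_cons_of_mem _ (ih h2 hlt)

section Executions

variable [Fintype V] [DecidableEq V] [DecidableEq τ] {p : Params} {G : SimpleGraph V}
  {H : Finset τ → β} {T₀ : V → Finset τ} {σ : Adversary V τ β}

/-- Every entry of the history is a possible outcome of the adversary's decision. -/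
def Possible (H : Finset τ → β) (T₀ : V → Finset τ) (σ : Adversary V τ β) :
    History V τ β → Prop
  | [] => True
  | r :: g => r ∈ (nextRecord H T₀ σ g).support ∧ Possible H T₀ σ g

/-- `ρ` is a possible infinite execution that begins with the history `g`. -/
def Extends (H : Finset τ → β) (T₀ : V → Finset τ) (σ : Adversary V τ β)
    (ρ : ℕ → Record V τ β) (g : History V τ β) : Prop :=
  IsExecution H T₀ σ ρ ∧ prefixHistory ρ g.length = g

lemma Extends.of_append {ρ : ℕ → Record V τ β} {new g : History V τ β}
    (h : Extends H T₀ σ ρ (new ++ g)) : Extends H T₀ σ ρ g :=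
  ⟨h.1, prefixHistory_length_of_append h.2⟩

lemma Extends.of_cons {ρ : ℕ → Record V τ β} {r : Record V τ β} {g : History V τ β}
    (h : Extends H T₀ σ ρ (r :: g)) : Extends H T₀ σ ρ g :=
  Extends.of_append (new := [r]) h

lemma exists_append_of_mem_run {N : ℕ} {g g' : History V τ β}
    (h : g' ∈ (run H T₀ σ N g).support) : ∃ new, g' = new ++ g := by
  induction N generalizing g with
  | zero =>
    obtain rfl : g' = g := by simpa [run] using h
    exact ⟨[], rfl⟩
  | succ N ih =>
    simp only [run, PMF.mem_support_bind_iff] at h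
    obtain ⟨r, hr, h⟩ := h
    obtain ⟨new, rfl⟩ := ih h
    exact ⟨new ++ [r], by simp⟩

lemma Possible.of_mem_run {N : ℕ} {g g' : History V τ β} (hg : Possible H T₀ σ g)
    (h : g' ∈ (run H T₀ σ N g).support) : Possible H T₀ σ g' := by
  induction N generalizing g with
  | zero =>
    obtain rfl : g' = g := by simpa [run] using h
    exact hg
  | succ N ih =>
    simp only [run, PMF.mem_support_bind_iff] at h
    obtain ⟨r, hr, h⟩ := h
    exact ih (g := r :: g) ⟨hr, hg⟩ h

lemma exists_extends_of_seq {g : ℕ → History V τ β} {r : ℕ → Record V τ β}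
    (hg : ∀ k, g (k + 1) = r k :: g k) (hr : ∀ k, r k ∈ (nextRecord H T₀ σ (g k)).support)
    (h0 : Possible H T₀ σ (g 0)) :
    ∃ ρ, IsExecution H T₀ σ ρ ∧ ∀ k, prefixHistory ρ ((g 0).length + k) = g k := by
  generalize hl : g 0 = l at h0
  induction l generalizing g r with
  | nil =>
    have key : ∀ k, prefixHistory r k = g k := by
      intro k
      induction k with
      | zero => rw [hl]; rfl
      | succ k ih => rw [hg, ← ih]; rfl
    exact ⟨r, fun k => by rw [key]; exact hr k, by simpa using key⟩
  | cons a l ih =>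
    obtain ⟨ρ, h1, h2⟩ := ih (g := fun k => Nat.casesOn k l g) (r := fun k => Nat.casesOn k a r)
      (by rintro (_ | k) <;> simp [hl, hg]) (by rintro (_ | k); exacts [h0.1, hr k]) rfl h0.2
    refine ⟨ρ, h1, fun k => ?_⟩
    have := h2 (k + 1)
    rwa [show l.length + (k + 1) = (a :: l).length + k by rw [List.length_cons]; omega] at this

/-- A property of histories that can always be maintained for one more event holds along some
infinite execution. -/
lemma exists_extends_forall {B : History V τ β → Prop} {g : History V τ β}
    (hg : Possible H T₀ σ g) (hB : B g)
    (hstep : ∀ g, B g → ∃ r ∈ (nextRecord H T₀ σ g).support, B (r :: g)) :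
    ∃ ρ, Extends H T₀ σ ρ g ∧ ∀ k, B (prefixHistory ρ (g.length + k)) := by
  choose f hf hfB using hstep
  let s : ℕ → {g // B g} := fun k => Nat.rec ⟨g, hB⟩ (fun _ x => ⟨f x.1 x.2 :: x.1, hfB _ _⟩) k
  obtain ⟨ρ, h1, h2⟩ := exists_extends_of_seq (g := fun k => (s k).1)
    (r := fun k => f (s k).1 (s k).2) (fun _ => rfl) (fun k => hf _ (s k).2) hg
  exact ⟨ρ, ⟨h1, h2 0⟩, fun k => (h2 k).symm ▸ (s k).2⟩

lemma Possible.exists_extends {g : History V τ β} (hg : Possible H T₀ σ g) :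
    ∃ ρ, Extends H T₀ σ ρ g := by
  obtain ⟨ρ, h, -⟩ := exists_extends_forall (B := fun _ => True) hg trivial
    fun g _ => (nextRecord H T₀ σ g).support_nonempty.imp fun _ hr => ⟨hr, trivial⟩
  exact ⟨ρ, h⟩

/-- The only randomness is the choice of a node, so every event has finitely many outcomes. -/
lemma finite_support_nextRecord (g : History V τ β) :
    (nextRecord H T₀ σ g).support.Finite := by
  rw [nextRecord, PMF.support_map]
  refine Set.Finite.image _ ?_
  rcases (σ g).2 with u | ⟨u, w⟩ | u | ⟨u, w⟩ | u | ⟨u, w, x, y⟩ | ⟨u, w⟩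
  all_goals try (simp [effect]; done)
  simp only [effect]
  split_ifs with hN
  · rw [PMF.support_map]
    exact Set.Finite.image _ (Set.toFinite _)
  · simp

lemma IsExecution.apply_eq {ρ : ℕ → Record V τ β} (h : IsExecution H T₀ σ ρ) (k : ℕ) :
    (ρ k).time = (σ (prefixHistory ρ k)).1 ∧ (ρ k).action = (σ (prefixHistory ρ k)).2 ∧
      (ρ k).state ∈ (effect H (History.state T₀ (prefixHistory ρ k))
        (σ (prefixHistory ρ k)).2).support := by
  have := h k
  rw [nextRecord, PMF.support_map] at this
  obtain ⟨s, hs, he⟩ := this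
  rw [← he]
  exact ⟨rfl, rfl, hs⟩

lemma Adversary.Admissible.trajectory (hσ : σ.Admissible p G H T₀) {ρ : ℕ → Record V τ β}
    (h : IsExecution H T₀ σ ρ) : Trajectory p G H T₀ ρ where
  toGuarantees := hσ ρ h
  step k := by
    obtain ⟨-, h2, h3⟩ := h.apply_eq k
    rw [h2]
    exact h3

/-- By König's lemma, the number of events in bounded time is bounded uniformly over all
continuations of a history. -/
lemma exists_forall_lt_clock (hσ : σ.Admissible p G H T₀) {g : History V τ β}
    (hg : Possible H T₀ σ g) (t : ℝ) :
    ∃ N, ∀ g' ∈ (run H T₀ σ N g).support, t < History.clock g' := by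
  let B : History V τ β → Prop := fun g => Possible H T₀ σ g ∧
    ¬ ∃ N, ∀ N' ≥ N, ∀ g' ∈ (run H T₀ σ N' g).support, t < History.clock g'
  -- if `g` has no bound, then, there being finitely many outcomes, neither has some successor
  by_contra hcon
  have hBg : B g := ⟨hg, fun ⟨N, hN⟩ => hcon ⟨N, hN N le_rfl⟩⟩
  obtain ⟨ρ, hρ, hρB⟩ := exists_extends_forall hg hBg (by
    rintro g ⟨hg, hB⟩
    by_contra! hno
    have hgood : ∀ r ∈ (nextRecord H T₀ σ g).support, ∃ N, ∀ N' ≥ N,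
        ∀ g' ∈ (run H T₀ σ N' (r :: g)).support, t < History.clock g' := by
      intro r hr
      by_contra hr'
      exact hno r hr ⟨⟨hr, hg⟩, hr'⟩
    choose! M hM using hgood
    have hfin := finite_support_nextRecord (H := H) (T₀ := T₀) (σ := σ) g
    refine hB ⟨hfin.toFinset.sup M + 1, ?_⟩
    rintro (_ | N') hN' g' hg'
    · omega
    simp only [run, PMF.mem_support_bind_iff] at hg'
    obtain ⟨r, hr, hg'⟩ := hg'
    refine hM r hr N' ?_ g' hg'
    have := Finset.le_sup (f := M) (hfin.mem_toFinset.2 hr)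
    omega)
  have htr := hσ.trajectory hρ.1
  obtain ⟨c, hc, -, hct⟩ := htr.exists_cut (k := g.length) (B := max t (clockAt ρ g.length))
    (le_max_right _ _)
  obtain ⟨j, hj⟩ : ∃ j, c + 1 = g.length + j := ⟨c + 1 - g.length, by omega⟩
  have hBj := hρB j
  rw [← hj] at hBj
  refine hBj.2 ⟨0, fun N' _ g' hg' => ?_⟩
  have hp' := hBj.1.of_mem_run hg'
  obtain ⟨new, rfl⟩ := exists_append_of_mem_run hg'
  obtain ⟨ρ', hρ'⟩ := hp'.exists_extends
  have h1 := (hσ.trajectory hρ'.1).clockAt_mono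
    (show c + 1 ≤ (new ++ prefixHistory ρ (c + 1)).length by
      simp [length_prefixHistory])
  have h2 := hρ'.of_append.2
  rw [length_prefixHistory] at h2
  have h3 := hρ'.2
  unfold clockAt at h1
  rw [h3, h2] at h1
  exact ((le_max_left _ _).trans_lt hct).trans_le h1

/-! ### The probability of success -/

/-- A product bound for adaptively scheduled trials. Suppose that along every execution that
extends `g` either `P` holds, or each `u ∈ D` still has, no later than `t`, a selection after which
`P` is not yet certain only with probability at most `q u`. Then after enough events `P` is
uncertain only with probability at most `∏ u ∈ D, q u`, however the trials are interleaved. -/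
lemma toOuterMeasure_run_compl_le {P : (ℕ → Record V τ β) → Prop} {q : V → ENNReal} {t : ℝ}
    {S : Set (History V τ β)} (N : ℕ) (g : History V τ β) (D : Finset V)
    (hend : ∀ g' ∈ (run H T₀ σ N g).support,
      ∀ ρ, Extends H T₀ σ ρ g' → ∀ i, g'.length ≤ i → t < (ρ i).time)
    (hS : ∀ g' ∈ (run H T₀ σ N g).support, (∀ ρ, Extends H T₀ σ ρ g' → P ρ) → g' ∈ S)
    (hD : ∀ ρ, Extends H T₀ σ ρ g → P ρ ∨ ∀ u ∈ D, ∃ k, g.length ≤ k ∧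
      (ρ k).time ≤ t ∧ (σ (prefixHistory ρ k)).2 = .select u ∧
      (nextRecord H T₀ σ (prefixHistory ρ k)).toOuterMeasure
        {r | ¬ ∀ ρ', Extends H T₀ σ ρ' (r :: prefixHistory ρ k) → P ρ'} ≤ q u) :
    (run H T₀ σ N g).toOuterMeasure Sᶜ ≤ ∏ u ∈ D, q u := by
  classical
  induction N generalizing g D with
  | zero =>
    simp only [run, PMF.support_pure, Set.mem_singleton_iff, forall_eq] at hend hS
    rcases D.eq_empty_or_nonempty with rfl | ⟨u, hu⟩
    · rw [run, PMF.toOuterMeasure_pure_apply]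
      split_ifs <;> simp
    · have hg : g ∈ S := hS fun ρ hρ => (hD ρ hρ).resolve_right fun hall => by
        obtain ⟨k, hk, hkt, -⟩ := hall u hu
        exact absurd (hend ρ hρ k hk) (not_lt.2 hkt)
      simp [run, PMF.toOuterMeasure_pure_apply, hg]
  | succ N ih =>
    have hsup : ∀ r ∈ (nextRecord H T₀ σ g).support, ∀ g' ∈ (run H T₀ σ N (r :: g)).support,
        g' ∈ (run H T₀ σ (N + 1) g).support := fun r hr g' hg' => by
      simp only [run, PMF.mem_support_bind_iff]
      exact ⟨r, hr, hg'⟩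
    rw [run, PMF.toOuterMeasure_bind_apply]
    -- the trials of `D'` are not affected by an event that is not one of them
    have pass : ∀ D' ⊆ D, (∀ u ∈ D', ¬ ((σ g).2 = .select u ∧
        (nextRecord H T₀ σ g).toOuterMeasure
          {r | ¬ ∀ ρ', Extends H T₀ σ ρ' (r :: g) → P ρ'} ≤ q u)) →
        ∀ r ∈ (nextRecord H T₀ σ g).support,
          (run H T₀ σ N (r :: g)).toOuterMeasure Sᶜ ≤ ∏ u ∈ D', q u := by
      intro D' hD' hno r hr
      refine ih (r :: g) D' (fun g' hg' => hend g' (hsup r hr g' hg'))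
        (fun g' hg' => hS g' (hsup r hr g' hg')) fun ρ hρ => ?_
      refine (hD ρ hρ.of_cons).imp_right fun hall u hu => ?_
      obtain ⟨k, hk, hkt, hsel, hle⟩ := hall u (hD' hu)
      refine ⟨k, ?_, hkt, hsel, hle⟩
      rcases hk.eq_or_lt with rfl | hk
      · rw [hρ.of_cons.2] at hsel hle
        exact absurd ⟨hsel, hle⟩ (hno u hu)
      · exact hk
    by_cases hQ : ∃ u ∈ D, (σ g).2 = .select u ∧ (nextRecord H T₀ σ g).toOuterMeasure
          {r | ¬ ∀ ρ', Extends H T₀ σ ρ' (r :: g) → P ρ'} ≤ q u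
    · obtain ⟨u, hu, hsel, hle⟩ := hQ
      have hpass := pass (D.erase u) (Finset.erase_subset _ _) fun u' hu' hc => by
        rw [hsel] at hc
        exact Finset.ne_of_mem_erase hu' (Action.select.inj hc.1).symm
      calc ∑' r, nextRecord H T₀ σ g r * (run H T₀ σ N (r :: g)).toOuterMeasure Sᶜ
          ≤ ∑' r, Set.indicator {r | ¬ ∀ ρ', Extends H T₀ σ ρ' (r :: g) → P ρ'}
              (nextRecord H T₀ σ g) r * ∏ u ∈ D.erase u, q u := by
            refine ENNReal.tsum_le_tsum fun r => ?_
            by_cases hr : r ∈ (nextRecord H T₀ σ g).support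
            swap
            · rw [PMF.mem_support_iff, not_not] at hr
              simp [hr]
            by_cases hW : ∀ ρ', Extends H T₀ σ ρ' (r :: g) → P ρ'
            · have h0 : (run H T₀ σ N (r :: g)).toOuterMeasure Sᶜ = 0 := by
                rw [PMF.toOuterMeasure_apply_eq_zero_iff, Set.disjoint_compl_right_iff_subset]
                intro g' hg'
                refine hS g' (hsup r hr g' hg') fun ρ hρ => ?_
                obtain ⟨new, rfl⟩ := exists_append_of_mem_run hg'
                exact hW ρ hρ.of_append
              rw [h0, mul_zero]
              exact zero_le
            · rw [Set.indicator_of_mem (by exact hW)]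
              gcongr
              exact hpass r hr
        _ = (nextRecord H T₀ σ g).toOuterMeasure
              {r | ¬ ∀ ρ', Extends H T₀ σ ρ' (r :: g) → P ρ'} * ∏ u ∈ D.erase u, q u := by
            rw [ENNReal.tsum_mul_right, PMF.toOuterMeasure_apply]
        _ ≤ q u * ∏ u ∈ D.erase u, q u := by gcongr
        _ = ∏ u ∈ D, q u := Finset.mul_prod_erase D q hu
    · calc ∑' r, nextRecord H T₀ σ g r * (run H T₀ σ N (r :: g)).toOuterMeasure Sᶜ
          ≤ ∑' r, nextRecord H T₀ σ g r * ∏ u ∈ D, q u := by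
            refine ENNReal.tsum_le_tsum fun r => ?_
            by_cases hr : r ∈ (nextRecord H T₀ σ g).support
            · gcongr
              exact pass D subset_rfl (fun u hu hc => hQ ⟨u, hu, hc⟩) r hr
            · rw [PMF.mem_support_iff, not_not] at hr
              simp [hr]
        _ = ∏ u ∈ D, q u := by rw [ENNReal.tsum_mul_right, PMF.tsum_coe, one_mul]

end Executions

end AMTM

namespace AMTM

variable {V τ β : Type*} [Fintype V] [DecidableEq V] [DecidableEq τ] {p : Params}
  {G : SimpleGraph V} {H : Finset τ → β} {T₀ : V → Finset τ} {σ : Adversary V τ β}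

/-- If `v` is one of at most `d` candidates of a selection, then `v` is not chosen with
probability at most `1 - 1 / d`. -/
lemma toOuterMeasure_nextRecord_select_le {g : History V τ β} {u v : V} {d : ℕ}
    (hsel : (σ g).2 = .select u)
    (hv : v ∈ NHat H ((History.state T₀ g).tok u) ((History.state T₀ g).inbox u))
    (hd : (NHat H ((History.state T₀ g).tok u) ((History.state T₀ g).inbox u)).card ≤ d) :
    (nextRecord H T₀ σ g).toOuterMeasure {r | r.state.phase u ≠ .proposing v} ≤
      ENNReal.ofReal (1 - 1 / (d : ℝ)) := by
  classical
  have hN : (NHat H ((History.state T₀ g).tok u) ((History.state T₀ g).inbox u)).Nonempty :=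
    ⟨v, hv⟩
  rw [nextRecord, hsel]
  simp only [effect, dif_pos hN]
  rw [PMF.toOuterMeasure_map_apply, PMF.toOuterMeasure_map_apply,
    PMF.toOuterMeasure_uniformOfFinset_apply]
  generalize NHat H ((History.state T₀ g).tok u) ((History.state T₀ g).inbox u) = M at *
  have hfilter : M.filter (fun w => w ≠ v) = M.erase v := Finset.filter_ne' M v
  simp only [Set.preimage_ofPred_eq, State.setPhase, Function.update_self, Set.mem_ofPred_eq,
    ne_eq, Phase.proposing.injEq] at hfilter ⊢
  rw [hfilter, Finset.card_erase_of_mem hv]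
  have hpos : 0 < M.card := hN.card_pos
  have hposR : (0 : ℝ) < M.card := by exact_mod_cast hpos
  rw [← ENNReal.ofReal_natCast, ← ENNReal.ofReal_natCast, ← ENNReal.ofReal_div_of_pos hposR]
  apply ENNReal.ofReal_le_ofReal
  rw [Nat.cast_sub hpos, Nat.cast_one, sub_div, div_self hposR.ne']
  gcongr

/-! ### The minimum productive subgraph -/

section Subgraph

omit [DecidableEq V] [DecidableEq τ]

variable {T : V → Finset τ} {U : Finset τ}

lemma adj_of_mem_Nmin {v u : V} (hv : v ∈ Smin T) (hu : u ∈ Nmin G H T v) :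
    G.Adj v u ∧ u ∉ Smin T := by
  classical
  simp only [Nmin, SimpleGraph.mem_neighborFinset] at hu
  obtain ⟨h1, ⟨h2, -⟩ | ⟨h2, -⟩⟩ := hu
  · exact absurd hv h2.1
  · exact ⟨h1.elim And.left fun h => h.1.symm, h2.1⟩

/-- The minimum-size neighbours of a node of `L_min` are among its neighbours in the minimum
productive subgraph. -/
lemma card_le_degMin (hinj : Set.InjOn H {S | S ⊆ U}) (hT : ∀ w, T w ⊆ U) {u : V}
    (hu : u ∉ Smin T) {M : Finset V} (hM : ∀ w ∈ M, G.Adj w u ∧ w ∈ Smin T) :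
    M.card ≤ degMin G H T u := by
  classical
  rw [degMin, ← SimpleGraph.card_neighborFinset_eq_degree]
  refine Finset.card_le_card fun w hw => ?_
  obtain ⟨hwu, hw⟩ := hM w hw
  rw [SimpleGraph.mem_neighborFinset]
  have hne : H (T w) ≠ H (T u) := fun he => by
    have heq := hinj (hT w) (hT u) he
    exact hu fun x => heq ▸ hw x
  refine ⟨Or.inl ⟨hwu.symm, hne, le_antisymm ?_ ?_⟩, Or.inl ⟨⟨hu, w, hw, hwu.symm⟩, hw, u, hu, hwu⟩⟩
  · refine le_csInf ⟨_, w, hwu.symm, hne, rfl⟩ ?_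
    rintro s ⟨x, -, -, rfl⟩
    exact hw x
  · exact Nat.sInf_le ⟨w, hwu.symm, hne, rfl⟩

end Subgraph

/-! ### The bound for a node of the minimum productive subgraph -/

/-- In every execution, `v` connects productively in time, or each `u ∈ N_min(v)` makes a selection
after which, with probability at least `1 / deg_min(u)`, the former is certain. -/
lemma productive_or_trials (hσ : σ.Admissible p G H T₀)
    (hinj : Set.InjOn H {S | S ⊆ Finset.univ.biUnion T₀}) {t₁ : ℝ} {h : History V τ β}
    (ht : History.clock h ≤ t₁) {v : V} (hv : v ∈ Smin (History.state T₀ h).tok)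
    {ρ : ℕ → Record V τ β} (hρ : Extends H T₀ σ ρ h) :
    (∃ i, h.length ≤ i ∧ (ρ i).action.ProductiveFor v ∧ (ρ i).time ≤ t₁ + 31 * p.δMax) ∨
    ∀ u ∈ Nmin G H (History.state T₀ h).tok v, ∃ k, h.length ≤ k ∧
      (ρ k).time ≤ t₁ + 31 * p.δMax ∧ (σ (prefixHistory ρ k)).2 = .select u ∧
      (nextRecord H T₀ σ (prefixHistory ρ k)).toOuterMeasure
        {r | ¬ ∀ ρ', Extends H T₀ σ ρ' (r :: prefixHistory ρ k) →
          ∃ i, h.length ≤ i ∧ (ρ' i).action.ProductiveFor v ∧ (ρ' i).time ≤ t₁ + 31 * p.δMax} ≤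
        ENNReal.ofReal (1 - 1 / (degMin G H (History.state T₀ h).tok u : ℝ)) := by
  have hp := p.δMax_pos
  rw [or_iff_not_imp_left]
  intro hnot u hu
  have htr := hσ.trajectory hρ.1
  obtain ⟨hvu, huS⟩ := adj_of_mem_Nmin hv hu
  have hstate : stateAt T₀ ρ h.length = History.state T₀ h := by rw [stateAt, hρ.2]
  rw [← hstate] at hv huS ⊢
  have htc : clockAt ρ h.length ≤ t₁ := by rwa [clockAt, hρ.2]
  obtain ⟨i, hi, hpi, hit⟩ | ⟨k, hnk, hsel, hk, hk', hmem, hM⟩ :=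
    htr.exists_qualified_select htc hinj hv hvu huS
  · exact absurd ⟨i, hi, hpi, by linarith⟩ hnot
  obtain ⟨htime, hact, -⟩ := hρ.1.apply_eq k
  rw [hact] at hsel
  refine ⟨k, hnk, by linarith, hsel, le_trans (PMF.toOuterMeasure_mono _ ?_)
    (toOuterMeasure_nextRecord_select_le hsel hmem
      (card_le_degMin hinj (htr.tok_subset_biUnion _) huS hM))⟩
  rintro r ⟨hr, -⟩ hph
  refine hr fun ρ' hρ' => ?_
  have hpre : prefixHistory ρ' k = prefixHistory ρ k := by
    simpa [length_prefixHistory] using hρ'.of_cons.2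
  have hrk : prefixHistory ρ' (k + 1) = r :: prefixHistory ρ k := by
    simpa [length_prefixHistory] using hρ'.2
  have hpre' := prefixHistory_eq_of_le hnk hpre
  have htr' := hσ.trajectory hρ'.1
  have htime' : (ρ' k).time = (ρ k).time := by rw [htime, (hρ'.1.apply_eq k).1, hpre]
  obtain ⟨i, hi, hpi, hit⟩ := htr'.exists_productive_of_proposing (n := h.length) (t₁ := t₁)
    (v := v) (k := k) (u := u) (by rwa [clockAt, hpre']) (by rwa [stateAt, hpre']) hnk
    (by rwa [htime']) (by rw [stateAt, hrk]; exact hph)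
  exact ⟨i, hi, hpi, by linarith⟩

end AMTM

theorem mainTheorem5 :
    ∃ C : ℝ, 0 < C ∧
      ∀ (V τ β : Type*) [Fintype V] [DecidableEq V] [DecidableEq τ]
        (p : AMTM.Params) (G : SimpleGraph V) (T₀ : V → Finset τ) (H : Finset τ → β),
        Set.InjOn H {S | S ⊆ Finset.univ.biUnion T₀} →
        ∀ σ : AMTM.Adversary V τ β, σ.Admissible p G H T₀ →
        ∀ (t₁ : ℝ) (n : ℕ) (h : AMTM.History V τ β),
          0 ≤ t₁ →
          h ∈ (AMTM.run H T₀ σ n []).support →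
          (∀ r ∈ h, r.time ≤ t₁) →
          t₁ ≤ (σ h).1 →
          ∀ v ∈ AMTM.Rmin G (AMTM.History.state T₀ h).tok,
            ∃ t₂ : ℝ, t₁ ≤ t₂ ∧ t₂ ≤ t₁ + C * p.δMax ∧
              ∃ N : ℕ,
                (∀ h' ∈ (AMTM.run H T₀ σ N h).support, t₂ < AMTM.History.clock h') ∧
                ENNReal.ofReal
                    (1 - ∏ u ∈ AMTM.Nmin G H (AMTM.History.state T₀ h).tok v,
                      (1 - 1 / (AMTM.degMin G H (AMTM.History.state T₀ h).tok u : ℝ))) ≤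
                  (AMTM.run H T₀ σ N h).toOuterMeasure
                    {h' | AMTM.ConnectsProductively h h' v t₁ t₂} := by
  refine ⟨31, by norm_num, ?_⟩
  intro V τ β _ _ _ p G T₀ H hinj σ hσ t₁ n h ht₁ hh hle hnext v hv
  have hp := p.δMax_pos
  have hposs : AMTM.Possible H T₀ σ h :=
    AMTM.Possible.of_mem_run (g := []) trivial hh
  have hclock : AMTM.History.clock h ≤ t₁ := by
    cases h with
    | nil => exact ht₁
    | cons r g => exact hle r List.mem_cons_self
  obtain ⟨N, hN⟩ := AMTM.exists_forall_lt_clock hσ hposs (t₁ + 31 * p.δMax)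
  refine ⟨t₁ + 31 * p.δMax, by linarith, le_rfl, N, hN, ?_⟩
  have late : ∀ g' ∈ (AMTM.run H T₀ σ N h).support, ∀ ρ, AMTM.Extends H T₀ σ ρ g' →
      ∀ i, g'.length ≤ i → t₁ + 31 * p.δMax < (ρ i).time := by
    intro g' hg' ρ hρ i hi
    have hmono := (hσ.trajectory hρ.1).clockAt_mono (hi.trans (Nat.le_succ i))
    rw [AMTM.clockAt, hρ.2] at hmono
    exact (hN g' hg').trans_le hmono
  have hfail := AMTM.toOuterMeasure_run_compl_le (H := H) (T₀ := T₀) (σ := σ)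
    (P := fun ρ => ∃ i, h.length ≤ i ∧ (ρ i).action.ProductiveFor v ∧
      (ρ i).time ≤ t₁ + 31 * p.δMax)
    (S := {h' | AMTM.ConnectsProductively h h' v t₁ (t₁ + 31 * p.δMax)}) N h
    (AMTM.Nmin G H (AMTM.History.state T₀ h).tok v) late ?_
    fun ρ hρ => AMTM.productive_or_trials hσ hinj hclock hv.1 hρ
  · have hnonneg : ∀ u ∈ AMTM.Nmin G H (AMTM.History.state T₀ h).tok v,
        (0 : ℝ) ≤ 1 - 1 / (AMTM.degMin G H (AMTM.History.state T₀ h).tok u : ℝ) :=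
      fun u _ => by simpa using Nat.cast_inv_le_one _
    rw [ENNReal.ofReal_sub _ (Finset.prod_nonneg hnonneg), ENNReal.ofReal_one,
      ENNReal.ofReal_prod_of_nonneg hnonneg, tsub_le_iff_right]
    have hone : (1 : ENNReal) = (AMTM.run H T₀ σ N h).toOuterMeasure Set.univ :=
      ((PMF.toOuterMeasure_apply_eq_one_iff _ _).2 (Set.subset_univ _)).symm
    rw [hone, ← Set.union_compl_self
      {h' | AMTM.ConnectsProductively h h' v t₁ (t₁ + 31 * p.δMax)}]
    exact (MeasureTheory.measure_union_le _ _).trans (add_le_add le_rfl hfail)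
  · intro g' hg' hall
    obtain ⟨ρ, hρ⟩ := (hposs.of_mem_run hg').exists_extends
    obtain ⟨i, hi, hpi, hit⟩ := hall ρ hρ
    obtain ⟨new, rfl⟩ := AMTM.exists_append_of_mem_run hg'
    have hlt : i < (new ++ h).length := by
      by_contra! hge
      exact absurd (late _ hg' ρ hρ i hge) (not_lt.2 hit)
    refine ⟨new, rfl, ρ i, AMTM.mem_of_prefixHistory_eq_append hρ.2 hi hlt, ?_, hit, hpi⟩
    have htime := (hρ.1.apply_eq h.length).1
    rw [hρ.of_append.2] at htime
    exact (hnext.trans htime.ge).trans ((hσ.trajectory hρ.1).time_mono hi)
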